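/- **Theorem.** Let $K$ and $H$ be commutative locally compact Hausdorff hypergroups (in the sense of Jewett), with convolutions $\omega$, identities $e$ and involutions $x\mapsto\tilde x$. Let $K\times H$ be the product hypergroup: its convolution $\omega((x,x'),(y,y'))$ is the Radon product $\omega(x,y)\otimes\omega(x',y')$, its identity is $(e,e)$ and its involution is $(x,x')^{\sim}=(\tilde x,\tilde x')$. For a commutative hypergroup $K$ with Haar measure $m$ (Radon measures being normalised so that locally null Borel sets are null, so that $L^\infty(K)$ is taken modulo locally null functions), put $T_xf(y)=\int_K f\,d\omega(x,y)$ and let $$\widehat K=\Big\{\alpha\in C^b(K):\ \alpha\neq 0,\ \int_K\alpha\,d\omega(x,y)=\alpha(x)\alpha(y),\ \alpha(\tilde x)=\overline{\alpha(x)}\ \text{ for all } x,y\in K\Big\},$$ with the compact-open topology. For $\alpha\in\widehat K$, the hypergroup $K$ is called $\alpha$-amenable if there is a bounded linear functional $M$ on $L^\infty(K)$ with $M(\alpha)=1$ and $M(T_xf)=\alpha(x)M(f)$ for all $f\in L^\infty(K)$ and $x\in K$. For $\alpha\in\widehat K$ and $\beta\in\widehat H$ write $(\alpha\otimes\beta)(x,y)=\alpha(x)\beta(y)$.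 Then: (i) $(\alpha,\beta)\mapsto\alpha\otimes\beta$ is a homeomorphism from $\widehat K\times\widehat H$ onto $\widehat{K\times H}$, where the duals carry the compact-open topologies. (ii) For all $\alpha\in\widehat K$ and $\beta\in\widehat H$, the hypergroup $K\times H$ is $(\alpha\otimes\beta)$-amenable if and only if $K$ is $\alpha$-amenable and $H$ is $\beta$-amenable. -/

import Mathlib

open MeasureTheory Filter Topology Set
open scoped CompactlySupported BoundedContinuousFunction ENNReal ComplexConjugate

set_option linter.unusedSectionVars false

noncomputable section

/-! ### The Radon product of two measures -/

section RadonProduct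

variable {X Y : Type*} [TopologicalSpace X] [T2Space X] [LocallyCompactSpace X]
  [MeasurableSpace X] [BorelSpace X] [TopologicalSpace Y] [T2Space Y] [LocallyCompactSpace Y]
  [MeasurableSpace Y] [BorelSpace Y]

theorem integrable_slice (ν : Measure Y) [IsFiniteMeasureOnCompacts ν] (f : C_c(X × Y, ℝ)) (x : X) :
    Integrable (fun y => f (x, y)) ν := by
  refine Continuous.integrable_of_hasCompactSupport (by fun_prop) ?_
  refine HasCompactSupport.intro (f.hasCompactSupport.isCompact.image continuous_snd) ?_
  intro y hy
  by_contra h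
  exact hy ⟨(x, y), subset_tsupport _ h, rfl⟩

theorem integrable_marginal (μ : Measure X) (ν : Measure Y) [IsFiniteMeasureOnCompacts μ]
    [IsFiniteMeasureOnCompacts ν] (f : C_c(X × Y, ℝ)) :
    Integrable (fun x => ∫ y, f (x, y) ∂ν) μ := by
  have hk := f.hasCompactSupport.isCompact.image (continuous_snd (X := X) (Y := Y))
  refine Continuous.integrable_of_hasCompactSupport ?_ ?_
  · rw [← continuousOn_univ]
    refine continuousOn_integral_of_compact_support (f := fun x y => f (x, y)) hk ?_ ?_
    · exact (f.continuous.continuousOn)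
    · intro p y _ hy
      by_contra h
      exact hy ⟨(p, y), subset_tsupport _ h, rfl⟩
  · refine HasCompactSupport.intro
      (f.hasCompactSupport.isCompact.image (continuous_fst (X := X) (Y := Y))) ?_
    intro x hx
    have : ∀ y, f (x, y) = 0 := by
      intro y
      by_contra h
      exact hx ⟨(x, y), subset_tsupport _ h, rfl⟩
    simp [this]

/-- The positive functional `f ↦ ∫∫ f(x, y) dν(y) dμ(x)` on `C_c(X × Y)`. -/
def radonProdFunctional (μ : Measure X) (ν : Measure Y) [IsFiniteMeasureOnCompacts μ]
    [IsFiniteMeasureOnCompacts ν] : C_c(X × Y, ℝ) →ₚ[ℝ] ℝ :=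
  PositiveLinearMap.mk₀
    { toFun := fun f => ∫ x, ∫ y, f (x, y) ∂ν ∂μ
      map_add' := by
        intro f g
        rw [← integral_add (integrable_marginal μ ν f) (integrable_marginal μ ν g)]
        refine integral_congr_ae (.of_forall fun x => ?_)
        exact integral_add (integrable_slice ν f x) (integrable_slice ν g x)
      map_smul' := by
        intro c f
        simp only [CompactlySupportedContinuousMap.coe_smul, Pi.smul_apply, smul_eq_mul,
          integral_const_mul, RingHom.id_apply] }
    (fun _ hf => integral_nonneg fun x => integral_nonneg fun y => hf (x, y))

theorem ae_mem_support (μ : Measure X) [μ.Regular] : ∀ᵐ x ∂μ, x ∈ μ.support :=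
  Measure.support_mem_ae_of_regular

/-- A cutoff function on a locally compact Hausdorff space. -/
theorem exists_cutoff {Z : Type*} [TopologicalSpace Z] [T2Space Z] [LocallyCompactSpace Z]
    {C U : Set Z} (hC : IsCompact C) (hU : IsOpen U) (hCU : C ⊆ U) :
    ∃ g : C_c(Z, ℝ), (∀ z ∈ C, g z = 1) ∧ (∀ z ∉ U, g z = 0) ∧ ∀ z, 0 ≤ g z ∧ g z ≤ 1 := by
  obtain ⟨f, h1, h2, h3, h4⟩ := exists_continuous_one_zero_of_isCompact hC hU.isClosed_compl
    (disjoint_compl_right_iff_subset.mpr hCU)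
  exact ⟨⟨f, h3⟩, fun z hz => h1 hz, fun z hz => h2 hz, fun z => h4 z⟩

theorem integral_swap_of_support (μ : Measure X) (ν : Measure Y) [μ.Regular] [ν.Regular] (hμ : IsCompact μ.support)
    (hν : IsCompact ν.support) {f : X → Y → ℝ} (hf : Continuous f.uncurry) :
    ∫ x, ∫ y, f x y ∂ν ∂μ = ∫ y, ∫ x, f x y ∂μ ∂ν := by
  obtain ⟨g, g1, -, -⟩ := exists_cutoff (hμ.prod hν) isOpen_univ (subset_univ _)
  have key := integral_integral_swap_of_hasCompactSupport (f := fun x y => f x y * g (x, y))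
    (μ := μ) (ν := ν) (by
      change Continuous fun p : X × Y => f.uncurry p * g p
      fun_prop) (by
      change HasCompactSupport fun p : X × Y => f.uncurry p * g p
      exact g.hasCompactSupport.mul_left)
  convert key using 1
  · refine integral_congr_ae ?_
    filter_upwards [ae_mem_support μ] with x hx
    refine integral_congr_ae ?_
    filter_upwards [ae_mem_support ν] with y hy
    rw [g1 _ ⟨hx, hy⟩, mul_one]
  · refine integral_congr_ae ?_
    filter_upwards [ae_mem_support ν] with y hy
    refine integral_congr_ae ?_
    filter_upwards [ae_mem_support μ] with x hx
    rw [g1 _ ⟨hx, hy⟩, mul_one]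

variable [MeasurableSpace (X × Y)] [BorelSpace (X × Y)]

/-- The Radon product `μ ⊗ ν`: the Radon measure on the Borel sets of `X × Y` representing the
functional `f ↦ ∫∫ f(x, y) dν(y) dμ(x)`, `f ∈ C_c(X × Y)`. (Without countability assumptions the
Borel `σ`-algebra of `X × Y` can be larger than the product `σ`-algebra.) -/
def radonProd (μ : Measure X) (ν : Measure Y) [IsFiniteMeasureOnCompacts μ]
    [IsFiniteMeasureOnCompacts ν] : Measure (X × Y) :=
  RealRMK.rieszMeasure (radonProdFunctional μ ν)

instance regular_radonProd (μ : Measure X) (ν : Measure Y) [IsFiniteMeasureOnCompacts μ]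
    [IsFiniteMeasureOnCompacts ν] : (radonProd μ ν).Regular := by
  unfold radonProd; infer_instance

theorem integral_radonProd_cc (μ : Measure X) (ν : Measure Y) [IsFiniteMeasureOnCompacts μ]
    [IsFiniteMeasureOnCompacts ν] (f : C_c(X × Y, ℝ)) :
    ∫ p, f p ∂(radonProd μ ν) = ∫ x, ∫ y, f (x, y) ∂ν ∂μ :=
  RealRMK.integral_rieszMeasure _ f

theorem radonProd_open_le (μ : Measure X) (ν : Measure Y) [IsFiniteMeasureOnCompacts μ]
    [IsFiniteMeasureOnCompacts ν] {U : Set (X × Y)} (hU : IsOpen U) {c : ℝ≥0∞}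
    (h : ∀ g : C_c(X × Y, ℝ), (∀ z ∉ U, g z = 0) → (∀ z, 0 ≤ g z ∧ g z ≤ 1) →
      ENNReal.ofReal (∫ x, ∫ y, g (x, y) ∂ν ∂μ) ≤ c) :
    radonProd μ ν U ≤ c := by
  rw [hU.measure_eq_iSup_isCompact]
  refine iSup₂_le fun L hLU => iSup_le fun hL => ?_
  obtain ⟨g, g1, g2, g3⟩ := exists_cutoff hL hU hLU
  exact (RealRMK.rieszMeasure_le_of_eq_one _ (fun z => (g3 z).1) hL g1).trans (h g g2 g3)

variable (μ : Measure X) (ν : Measure Y) [IsProbabilityMeasure μ] [IsProbabilityMeasure ν]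

theorem isProbabilityMeasure_radonProd [μ.Regular] [ν.Regular] (hμ : IsCompact μ.support)
    (hν : IsCompact ν.support) : IsProbabilityMeasure (radonProd μ ν) := by
  constructor
  apply le_antisymm
  · refine radonProd_open_le μ ν isOpen_univ fun g _ hg => ?_
    rw [← ENNReal.ofReal_one]
    apply ENNReal.ofReal_le_ofReal
    calc ∫ x, ∫ y, g (x, y) ∂ν ∂μ ≤ ∫ x, (1 : ℝ) ∂μ := by
          refine integral_mono (integrable_marginal μ ν g) (integrable_const _) fun x => ?_
          calc ∫ y, g (x, y) ∂ν ≤ ∫ y, (1 : ℝ) ∂ν :=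
                integral_mono (integrable_slice ν g x) (integrable_const _) fun y => (hg _).2
            _ = 1 := by simp
      _ = 1 := by simp
  · obtain ⟨g, g1, -, g3⟩ := exists_cutoff (hμ.prod hν) isOpen_univ (subset_univ _)
    have h := RealRMK.le_rieszMeasure_tsupport_subset (radonProdFunctional μ ν) g3
      (subset_univ (tsupport g))
    have h1 : ∫ x, ∫ y, g (x, y) ∂ν ∂μ = 1 := by
      have : (fun x => ∫ y, g (x, y) ∂ν) =ᵐ[μ] fun _ => (1 : ℝ) := by
        filter_upwards [ae_mem_support μ] with x hx
        have : (fun y => g (x, y)) =ᵐ[ν] fun _ => (1 : ℝ) := by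
          filter_upwards [ae_mem_support ν] with y hy using g1 _ ⟨hx, hy⟩
        simp [integral_congr_ae this]
      simp [integral_congr_ae this]
    have h2 : radonProdFunctional μ ν g = 1 := h1
    rw [h2, ENNReal.ofReal_one] at h
    exact h

theorem support_radonProd [μ.Regular] [ν.Regular] (hμ : IsCompact μ.support)
    (hν : IsCompact ν.support) : (radonProd μ ν).support = μ.support ×ˢ ν.support := by
  apply subset_antisymm
  · refine Measure.support_subset_of_isClosed (hμ.prod hν).isClosed ?_
    rw [mem_ae_iff]
    refine le_antisymm (radonProd_open_le μ ν (hμ.prod hν).isClosed.isOpen_compl fun g hg _ => ?_)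
      bot_le
    have : (fun x => ∫ y, g (x, y) ∂ν) =ᵐ[μ] fun _ => (0 : ℝ) := by
      filter_upwards [ae_mem_support μ] with x hx
      have : (fun y => g (x, y)) =ᵐ[ν] fun _ => (0 : ℝ) := by
        filter_upwards [ae_mem_support ν] with y hy using hg _ (not_not.mpr ⟨hx, hy⟩)
      simp [integral_congr_ae this]
    simp [integral_congr_ae this]
  · rintro ⟨x, y⟩ ⟨hx, hy⟩
    rw [Measure.support_eq_forall_isOpen]
    intro U hxU hU
    obtain ⟨V, W, hV, hW, hxV, hyW, hVW⟩ := isOpen_prod_iff.mp hU x y hxU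
    obtain ⟨a, a1, a2, a3⟩ := exists_cutoff isCompact_singleton hV (singleton_subset_iff.mpr hxV)
    obtain ⟨b, b1, b2, b3⟩ := exists_cutoff isCompact_singleton hW (singleton_subset_iff.mpr hyW)
    have pa : 0 < ∫ s, a s ∂μ := by
      rw [integral_pos_iff_support_of_nonneg (fun s => (a3 s).1) a.integrable]
      refine (Measure.mem_support_iff_forall x).mp hx _ (a.continuous.isOpen_support.mem_nhds ?_)
      simp [a1 x rfl]
    have pb : 0 < ∫ s, b s ∂ν := by
      rw [integral_pos_iff_support_of_nonneg (fun s => (b3 s).1) b.integrable]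
      refine (Measure.mem_support_iff_forall y).mp hy _ (b.continuous.isOpen_support.mem_nhds ?_)
      simp [b1 y rfl]
    let g : C_c(X × Y, ℝ) :=
      ⟨⟨fun p => a p.1 * b p.2, by fun_prop⟩, by
        refine HasCompactSupport.intro
          (a.hasCompactSupport.isCompact.prod b.hasCompactSupport.isCompact) ?_
        rintro ⟨s, t⟩ hst
        by_contra h
        exact hst ⟨subset_tsupport _ (left_ne_zero_of_mul h),
          subset_tsupport _ (right_ne_zero_of_mul h)⟩⟩
    have hg : ∫ p, g p ∂(radonProd μ ν) = (∫ s, a s ∂μ) * ∫ t, b t ∂ν := by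
      rw [integral_radonProd_cc]
      change ∫ s, ∫ t, a s * b t ∂ν ∂μ = _
      simp only [integral_const_mul, integral_mul_const]
    by_contra hzero
    have h0 : radonProd μ ν U = 0 := by simpa using hzero
    have : g =ᵐ[radonProd μ ν] fun _ => (0 : ℝ) := by
      have hU' : ∀ᵐ p ∂(radonProd μ ν), p ∉ U := measure_eq_zero_iff_ae_notMem.mp h0
      filter_upwards [hU'] with p hp
      change a p.1 * b p.2 = 0
      by_cases h1 : p.1 ∈ V
      · rw [b2 p.2 fun h2 => hp (hVW ⟨h1, h2⟩), mul_zero]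
      · rw [a2 p.1 h1, zero_mul]
    rw [integral_congr_ae this, integral_zero] at hg
    exact (mul_pos pa pb).ne hg

theorem integral_radonProd_real [μ.Regular] [ν.Regular] (hμ : IsCompact μ.support)
    (hν : IsCompact ν.support) {f : X × Y → ℝ} (hf : Continuous f) :
    ∫ p, f p ∂(radonProd μ ν) = ∫ x, ∫ y, f (x, y) ∂ν ∂μ := by
  obtain ⟨g, g1, -, -⟩ := exists_cutoff (hμ.prod hν) isOpen_univ (subset_univ _)
  let F : C_c(X × Y, ℝ) := ⟨⟨fun p => f p * g p, by fun_prop⟩, g.hasCompactSupport.mul_left⟩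
  have h1 : ∫ p, f p ∂(radonProd μ ν) = ∫ p, F p ∂(radonProd μ ν) := by
    refine integral_congr_ae ?_
    filter_upwards [ae_mem_support (radonProd μ ν)] with p hp
    rw [support_radonProd μ ν hμ hν] at hp
    change f p = f p * g p
    rw [g1 p hp, mul_one]
  rw [h1, integral_radonProd_cc]
  refine integral_congr_ae ?_
  filter_upwards [ae_mem_support μ] with x hx
  refine integral_congr_ae ?_
  filter_upwards [ae_mem_support ν] with y hy
  change f (x, y) * g (x, y) = f (x, y)
  rw [g1 _ ⟨hx, hy⟩, mul_one]

end RadonProduct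

/-! ### Hypergroups -/

/-- A (locally compact) hypergroup structure in the sense of Jewett on a locally compact Hausdorff
space `K` with its Borel `σ`-algebra: a convolution `(x, y) ↦ ω(x, y) = δ_x * δ_y`, an identity and
an involution. -/
class Hypergroup (K : Type*) [TopologicalSpace K] [MeasurableSpace K] where
  /-- The convolution `ω(x, y)` of the point masses at `x` and `y`. -/
  conv : K → K → Measure K
  /-- The identity element. -/
  e : K
  /-- The involution `x ↦ x̃`. -/
  inv : K → K
  isProbabilityMeasure_conv : ∀ x y, IsProbabilityMeasure (conv x y)
  regular_conv : ∀ x y, (conv x y).Regular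
  isCompact_support_conv : ∀ x y, IsCompact (conv x y).support
  /-- `(x, y) ↦ ω(x, y)` is weakly continuous. -/
  continuous_conv : ∀ f : K →ᵇ ℝ, Continuous fun p : K × K => ∫ t, f t ∂(conv p.1 p.2)
  /-- `(x, y) ↦ supp ω(x, y)` is continuous into the space of compact subsets of `K` with the
  Michael (Vietoris) topology. -/
  continuous_support_conv : Continuous fun p : K × K =>
    (⟨(conv p.1 p.2).support, isCompact_support_conv p.1 p.2⟩ : TopologicalSpace.Compacts K)
  /-- Associativity `(δ_x * δ_y) * δ_z = δ_x * (δ_y * δ_z)`. -/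
  conv_assoc : ∀ (x y z : K) (f : K →ᵇ ℝ),
    ∫ t, ∫ s, f s ∂(conv t z) ∂(conv x y) = ∫ t, ∫ s, f s ∂(conv x t) ∂(conv y z)
  e_conv : ∀ x, conv e x = Measure.dirac x
  conv_e : ∀ x, conv x e = Measure.dirac x
  continuous_inv : Continuous inv
  inv_inv : ∀ x, inv (inv x) = x
  /-- `(δ_x * δ_y)~ = δ_ỹ * δ_x̃`. -/
  map_inv_conv : ∀ x y, (conv x y).map inv = conv (inv y) (inv x)
  e_mem_support_conv_iff : ∀ x y, e ∈ (conv x y).support ↔ x = inv y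

/-- A commutative hypergroup: `ω(x, y) = ω(y, x)`. -/
class CommHypergroup (K : Type*) [TopologicalSpace K] [MeasurableSpace K]
    extends Hypergroup K where
  conv_comm : ∀ x y, conv x y = conv y x

namespace Hypergroup

attribute [instance] isProbabilityMeasure_conv regular_conv

section Basic

variable {K : Type*} [TopologicalSpace K] [T2Space K] [LocallyCompactSpace K]
  [MeasurableSpace K] [BorelSpace K] [Hypergroup K]

theorem integrable_conv {E : Type*} [NormedAddCommGroup E] [SecondCountableTopology E] (x y : K)
    {f : K → E} (hf : Continuous f) : Integrable f (conv x y) := by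
  have h := hf.continuousOn.integrableOn_compact (μ := conv x y) (isCompact_support_conv x y)
  rwa [IntegrableOn, Measure.restrict_eq_self_of_ae_mem (ae_mem_support (conv x y))] at h

theorem eventually_support_subset {P : Type*} [TopologicalSpace P] {a b : P → K}
    (ha : Continuous a) (hb : Continuous b) (p₀ : P) {U : Set K} (hU : IsOpen U)
    (h : (conv (a p₀) (b p₀)).support ⊆ U) :
    ∀ᶠ p in 𝓝 p₀, (conv (a p) (b p)).support ⊆ U :=
  ((continuous_support_conv (K := K)).comp (ha.prodMk hb)).continuousAt.eventually
    ((TopologicalSpace.Compacts.isOpen_subsets_of_isOpen hU).mem_nhds h)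

/-- Continuity of parametric integrals against `ω`. -/
theorem continuous_integral_conv {P : Type*} [TopologicalSpace P] {a b : P → K}
    (ha : Continuous a) (hb : Continuous b) {G : P → K → ℝ} (hG : Continuous G.uncurry) :
    Continuous fun p => ∫ s, G p s ∂(conv (a p) (b p)) := by
  rw [continuous_iff_continuousAt]
  intro p₀
  obtain ⟨C, hC, hCs⟩ := exists_compact_superset (isCompact_support_conv (a p₀) (b p₀))
  obtain ⟨g, g1, -, -⟩ := exists_cutoff hC isOpen_univ (subset_univ _)
  have hG0 : Continuous (G p₀) := hG.comp (Continuous.prodMk_right p₀)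
  let F : C_c(K, ℝ) := ⟨⟨fun s => G p₀ s * g s, by fun_prop⟩, g.hasCompactSupport.mul_left⟩
  have hF : Tendsto (fun p => ∫ s, F s ∂(conv (a p) (b p))) (𝓝 p₀)
      (𝓝 (∫ s, F s ∂(conv (a p₀) (b p₀)))) :=
    ((continuous_conv (K := K) (F : K →ᵇ ℝ)).comp (ha.prodMk hb)).continuousAt
  have hsupp := eventually_support_subset ha hb p₀ isOpen_interior hCs
  have hFG : ∀ p, (conv (a p) (b p)).support ⊆ interior C →
      ∫ s, F s ∂(conv (a p) (b p)) = ∫ s, G p₀ s ∂(conv (a p) (b p)) := by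
    intro p hp
    refine integral_congr_ae ?_
    filter_upwards [ae_mem_support (conv (a p) (b p))] with s hs
    change G p₀ s * g s = G p₀ s
    rw [g1 s (interior_subset (hp hs)), mul_one]
  rw [ContinuousAt, Metric.tendsto_nhds]
  intro ε hε
  have hunif : ∀ᶠ p in 𝓝 p₀, ∀ s ∈ C, dist (G p s) (G p₀ s) < ε / 2 := by
    refine hC.eventually_forall_of_forall_eventually fun s _ => ?_
    have h1 : Continuous fun z : P × K => dist (G z.1 z.2) (G p₀ z.2) :=
      (hG : Continuous fun z : P × K => G z.1 z.2).dist (hG0.comp continuous_snd)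
    refine h1.continuousAt.eventually_lt continuousAt_const ?_
    simpa using half_pos hε
  filter_upwards [hunif, hsupp, (Metric.tendsto_nhds.mp hF) (ε / 2) (half_pos hε)] with p h1 h2 h3
  rw [hFG p h2, hFG p₀ hCs] at h3
  have hGp : Continuous (G p) := hG.comp (Continuous.prodMk_right p)
  have h4 : dist (∫ s, G p s ∂(conv (a p) (b p))) (∫ s, G p₀ s ∂(conv (a p) (b p))) ≤ ε / 2 := by
    rw [dist_eq_norm, ← integral_sub (integrable_conv _ _ hGp) (integrable_conv _ _ hG0)]
    have := norm_integral_le_of_norm_le_const (μ := conv (a p) (b p))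
      (f := fun s => G p s - G p₀ s) (C := ε / 2) (by
        filter_upwards [ae_mem_support (conv (a p) (b p))] with s hs
        rw [← dist_eq_norm]
        exact (h1 s (interior_subset (h2 hs))).le)
    simpa using this
  calc _ ≤ _ := dist_triangle _ _ _
    _ < ε / 2 + ε / 2 := add_lt_add_of_le_of_lt h4 h3
    _ = ε := add_halves ε

theorem measurable_conv (x : K) : Measurable fun y : K => conv x y := by
  refine Measurable.measure_of_isPiSystem_of_isProbabilityMeasure
    (BorelSpace.measurable_eq (α := K)) isPiSystem_isOpen fun U hU => ?_
  refine LowerSemicontinuous.measurable fun y₀ r hr => ?_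
  change r < conv x y₀ U at hr
  rw [IsOpen.measure_eq_iSup_isCompact hU] at hr
  obtain ⟨L, hr⟩ := lt_iSup_iff.mp hr
  obtain ⟨hLU, hr⟩ := lt_iSup_iff.mp hr
  obtain ⟨hL, hr⟩ := lt_iSup_iff.mp hr
  obtain ⟨g, g1, g2, g3⟩ := exists_cutoff hL hU hLU
  have hle : ∀ y, ENNReal.ofReal (∫ s, g s ∂(conv x y)) ≤ conv x y U := fun y =>
    integral_le_measure (fun s _ => (g3 s).2) fun s hs => (g2 s hs).le
  have hge : conv x y₀ L ≤ ENNReal.ofReal (∫ s, g s ∂(conv x y₀)) :=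
    g.integrable.measure_le_integral (.of_forall fun s => (g3 s).1) fun s hs => (g1 s hs).ge
  have hc : Continuous fun y => ENNReal.ofReal (∫ s, g s ∂(conv x y)) :=
    ENNReal.continuous_ofReal.comp
      (continuous_integral_conv continuous_const continuous_id (G := fun _ s => g s)
        (g.continuous.comp continuous_snd))
  filter_upwards [hc.continuousAt.eventually_const_lt (hr.trans_le hge)] with y hy
  exact hy.trans_le (hle y)

end Basic

/-! ### The product of two hypergroups -/

section Product

variable {K H : Type*} [TopologicalSpace K] [T2Space K] [LocallyCompactSpace K]
  [MeasurableSpace K] [BorelSpace K] [TopologicalSpace H] [T2Space H] [LocallyCompactSpace H]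
  [MeasurableSpace H] [BorelSpace H] [MeasurableSpace (K × H)] [BorelSpace (K × H)]

section

variable [Hypergroup K] [Hypergroup H]

theorem integral_prodConv (x y : K) (x' y' : H) {f : K × H → ℝ} (hf : Continuous f) :
    ∫ p, f p ∂(radonProd (conv x y) (conv x' y')) =
      ∫ s, ∫ t, f (s, t) ∂(conv x' y') ∂(conv x y) :=
  integral_radonProd_real _ _ (isCompact_support_conv x y) (isCompact_support_conv x' y') hf

theorem continuous_iterated {P : Type*} [TopologicalSpace P] {a b : P → K} {a' b' : P → H}
    (ha : Continuous a) (hb : Continuous b) (ha' : Continuous a') (hb' : Continuous b')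
    {F : P → K → H → ℝ} (hF : Continuous fun z : (P × K) × H => F z.1.1 z.1.2 z.2) :
    Continuous fun p => ∫ s, ∫ t, F p s t ∂(conv (a' p) (b' p)) ∂(conv (a p) (b p)) :=
  continuous_integral_conv ha hb (G := fun p s => ∫ t, F p s t ∂(conv (a' p) (b' p)))
    (continuous_integral_conv (P := P × K) (ha'.comp continuous_fst) (hb'.comp continuous_fst)
      (G := fun z t => F z.1 z.2 t) hF)

theorem integral_swap_conv (x y : K) (x' y' : H) {f : K → H → ℝ} (hf : Continuous f.uncurry) :
    ∫ s, ∫ t, f s t ∂(conv x' y') ∂(conv x y) = ∫ t, ∫ s, f s t ∂(conv x y) ∂(conv x' y') :=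
  integral_swap_of_support _ _ (isCompact_support_conv x y) (isCompact_support_conv x' y') hf

theorem prodConv_eq_dirac {x y z : K} {x' y' z' : H} (h : conv x y = Measure.dirac z)
    (h' : conv x' y' = Measure.dirac z') :
    radonProd (conv x y) (conv x' y') = Measure.dirac (z, z') := by
  have hs := support_radonProd _ _ (isCompact_support_conv x y) (isCompact_support_conv x' y')
  have := isProbabilityMeasure_radonProd _ _ (isCompact_support_conv x y)
    (isCompact_support_conv x' y')
  have h1 : (conv x y).support ⊆ {z} :=
    Measure.support_subset_of_isClosed isClosed_singleton (by rw [h]; simp)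
  have h2 : (conv x' y').support ⊆ {z'} :=
    Measure.support_subset_of_isClosed isClosed_singleton (by rw [h']; simp)
  have hae : ∀ᵐ p ∂(radonProd (conv x y) (conv x' y')), p ∈ ({(z, z')} : Set (K × H)) := by
    filter_upwards [ae_mem_support (radonProd (conv x y) (conv x' y'))] with p hp
    rw [hs] at hp
    exact Prod.ext (h1 hp.1) (h2 hp.2)
  have hr := Measure.restrict_eq_self_of_ae_mem hae
  rw [Measure.restrict_singleton] at hr
  have hone : radonProd (conv x y) (conv x' y') {(z, z')} = 1 := by
    rw [← measure_univ (μ := radonProd (conv x y) (conv x' y'))]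
    exact measure_congr (eventuallyEq_univ.mpr hae)
  rw [← hr, hone, one_smul]

theorem prodConv_assoc (x y z : K) (x' y' z' : H) (f : K × H →ᵇ ℝ) :
    ∫ t, ∫ t', ∫ s, ∫ s', f (s, s') ∂(conv t' z') ∂(conv t z) ∂(conv x' y') ∂(conv x y) =
      ∫ t, ∫ t', ∫ s, ∫ s', f (s, s') ∂(conv x' t') ∂(conv x t) ∂(conv y' z') ∂(conv y z) := by
  have hf := f.continuous
  have hcont : Continuous fun s => ∫ t', ∫ s', f (s, s') ∂(conv x' t') ∂(conv y' z') :=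
    continuous_integral_conv (P := K) continuous_const continuous_const
      (G := fun s t' => ∫ s', f (s, s') ∂(conv x' t'))
      (continuous_integral_conv (P := K × H) continuous_const continuous_snd
        (G := fun p s' => f (p.1, s')) (by
          change Continuous fun z : (K × H) × H => f (z.1.1, z.2)
          fun_prop))
  have hbound : ∀ s, ‖∫ t', ∫ s', f (s, s') ∂(conv x' t') ∂(conv y' z')‖ ≤ ‖f‖ := by
    intro s
    have h1 : ∀ t', ‖∫ s', f (s, s') ∂(conv x' t')‖ ≤ ‖f‖ := fun t' => by
      simpa using norm_integral_le_of_norm_le_const (μ := conv x' t')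
        (.of_forall fun s' => f.norm_coe_le_norm (s, s'))
    simpa using norm_integral_le_of_norm_le_const (μ := conv y' z') (.of_forall h1)
  have hK := conv_assoc x y z (BoundedContinuousFunction.ofNormedAddCommGroup _ hcont _ hbound)
  simp only [BoundedContinuousFunction.coe_ofNormedAddCommGroup] at hK
  have hH : ∀ s, ∫ t', ∫ s', f (s, s') ∂(conv t' z') ∂(conv x' y') =
      ∫ t', ∫ s', f (s, s') ∂(conv x' t') ∂(conv y' z') := fun s =>
    conv_assoc x' y' z' (f.compContinuous ⟨fun t => (s, t), by fun_prop⟩)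
  calc _ = ∫ t, ∫ s, ∫ t', ∫ s', f (s, s') ∂(conv t' z') ∂(conv x' y') ∂(conv t z)
        ∂(conv x y) := by
        refine integral_congr_ae (.of_forall fun t => ?_)
        refine (integral_swap_conv t z x' y' (f := fun s t' => ∫ s', f (s, s') ∂(conv t' z'))
          ?_).symm
        exact continuous_integral_conv (P := K × H) continuous_snd continuous_const
          (G := fun p s' => f (p.1, s')) (by
            change Continuous fun z : (K × H) × H => f (z.1.1, z.2)
            fun_prop)
    _ = ∫ t, ∫ s, ∫ t', ∫ s', f (s, s') ∂(conv x' t') ∂(conv y' z') ∂(conv t z)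
        ∂(conv x y) := by simp_rw [hH]
    _ = ∫ t, ∫ s, ∫ t', ∫ s', f (s, s') ∂(conv x' t') ∂(conv y' z') ∂(conv x t)
        ∂(conv y z) := hK
    _ = _ := by
        refine integral_congr_ae (.of_forall fun t => ?_)
        refine integral_swap_conv x t y' z' (f := fun s t' => ∫ s', f (s, s') ∂(conv x' t')) ?_
        exact continuous_integral_conv (P := K × H) continuous_const continuous_snd
          (G := fun p s' => f (p.1, s')) (by
            change Continuous fun z : (K × H) × H => f (z.1.1, z.2)
            fun_prop)

/-- The involution of a hypergroup as a homeomorphism. -/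
def invHomeomorph (K : Type*) [TopologicalSpace K] [MeasurableSpace K] [Hypergroup K] : K ≃ₜ K where
  toFun := inv
  invFun := inv
  left_inv := inv_inv
  right_inv := inv_inv
  continuous_toFun := continuous_inv
  continuous_invFun := continuous_inv

theorem integral_comp_inv (x y : K) {f : K → ℝ} (hf : Continuous f) :
    ∫ s, f (inv s) ∂(conv x y) = ∫ s, f s ∂(conv (inv y) (inv x)) := by
  rw [← map_inv_conv, integral_map continuous_inv.measurable.aemeasurable
    hf.aestronglyMeasurable]

theorem map_inv_prodConv (x y : K) (x' y' : H) :
    (radonProd (conv x y) (conv x' y')).map (fun p : K × H => (inv p.1, inv p.2)) =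
      radonProd (conv (inv y) (inv x)) (conv (inv y') (inv x')) := by
  have hφ : Continuous fun p : K × H => (inv p.1, inv p.2) :=
    (continuous_inv.comp continuous_fst).prodMk (continuous_inv.comp continuous_snd)
  have : ((radonProd (conv x y) (conv x' y')).map
      (fun p : K × H => (inv p.1, inv p.2))).Regular :=
    Measure.Regular.map (μ := radonProd (conv x y) (conv x' y'))
      ((invHomeomorph K).prodCongr (invHomeomorph H))
  refine Measure.ext_of_integral_eq_on_compactlySupported fun f => ?_
  have hf : Continuous f := f.continuous
  rw [integral_map hφ.measurable.aemeasurable hf.aestronglyMeasurable,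
    integral_prodConv _ _ _ _ (f := fun p => f (inv p.1, inv p.2)) (hf.comp hφ),
    integral_prodConv _ _ _ _ hf]
  have h1 : ∀ s : K, ∫ t, f (inv s, inv t) ∂(conv x' y') =
      ∫ t, f (inv s, t) ∂(conv (inv y') (inv x')) := fun s =>
    integral_comp_inv x' y' (f := fun t => f (inv s, t)) (by fun_prop)
  simp only [h1]
  refine integral_comp_inv x y (f := fun s => ∫ t, f (s, t) ∂(conv (inv y') (inv x'))) ?_
  exact continuous_integral_conv continuous_const continuous_const
    (G := fun s t => f (s, t)) hf

/-- The product hypergroup `K × H`: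
`ω((x, x'), (y, y')) = ω(x, y) ⊗ ω(x', y')`, with identity `(e, e)` and `(x, x')~ = (x̃, x̃')`. -/
instance instProd : Hypergroup (K × H) where
  conv p q := radonProd (conv p.1 q.1) (conv p.2 q.2)
  e := (e, e)
  inv p := (inv p.1, inv p.2)
  isProbabilityMeasure_conv p q :=
    isProbabilityMeasure_radonProd _ _ (isCompact_support_conv _ _) (isCompact_support_conv _ _)
  regular_conv p q := inferInstance
  isCompact_support_conv p q := by
    rw [support_radonProd _ _ (isCompact_support_conv _ _) (isCompact_support_conv _ _)]
    exact (isCompact_support_conv _ _).prod (isCompact_support_conv _ _)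
  continuous_conv f := by
    simp_rw [integral_prodConv _ _ _ _ f.continuous]
    refine continuous_integral_conv (P := (K × H) × (K × H)) (a := fun p => p.1.1)
      (b := fun p => p.2.1) (by fun_prop) (by fun_prop)
      (G := fun p s => ∫ t, f (s, t) ∂(conv p.1.2 p.2.2)) ?_
    exact continuous_integral_conv (P := ((K × H) × (K × H)) × K) (a := fun p => p.1.1.2)
      (b := fun p => p.1.2.2) (by fun_prop) (by fun_prop)
      (G := fun p t => f (p.2, t)) (by
        change Continuous fun z : (((K × H) × (K × H)) × K) × H => f (z.1.2, z.2)
        fun_prop)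
  continuous_support_conv := by
    have h := TopologicalSpace.Compacts.continuous_prod.comp
      (((continuous_support_conv (K := K)).comp
        (by fun_prop : Continuous fun p : (K × H) × (K × H) => (p.1.1, p.2.1))).prodMk
      ((continuous_support_conv (K := H)).comp
        (by fun_prop : Continuous fun p : (K × H) × (K × H) => (p.1.2, p.2.2))))
    convert h using 2 with p
    exact TopologicalSpace.Compacts.ext
      (support_radonProd _ _ (isCompact_support_conv _ _) (isCompact_support_conv _ _))
  conv_assoc := by
    rintro ⟨x, x'⟩ ⟨y, y'⟩ ⟨z, z'⟩ f
    have hf := f.continuous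
    have hF : ∀ P : Type _, [TopologicalSpace P] → Continuous fun w : (P × K) × H =>
        f (w.1.2, w.2) := fun P _ => by fun_prop
    simp_rw [integral_prodConv _ _ _ _ hf]
    rw [integral_prodConv _ _ _ _ (continuous_iterated continuous_fst continuous_const
      continuous_snd continuous_const (F := fun _ s t => f (s, t)) (hF _)),
      integral_prodConv _ _ _ _ (continuous_iterated continuous_const continuous_fst
      continuous_const continuous_snd (F := fun _ s t => f (s, t)) (hF _))]
    exact prodConv_assoc x y z x' y' z' f
  e_conv p := prodConv_eq_dirac (e_conv p.1) (e_conv p.2)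
  conv_e p := prodConv_eq_dirac (conv_e p.1) (conv_e p.2)
  continuous_inv := (continuous_inv.comp continuous_fst).prodMk (continuous_inv.comp continuous_snd)
  inv_inv p := Prod.ext (inv_inv _) (inv_inv _)
  map_inv_conv p q := map_inv_prodConv p.1 q.1 p.2 q.2
  e_mem_support_conv_iff := by
    rintro ⟨x, x'⟩ ⟨y, y'⟩
    rw [support_radonProd _ _ (isCompact_support_conv _ _) (isCompact_support_conv _ _)]
    simp [e_mem_support_conv_iff, Prod.ext_iff]

end

/-- The product of two commutative hypergroups is a commutative hypergroup. -/
instance instCommProd [CommHypergroup K] [CommHypergroup H] : CommHypergroup (K × H) where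
  toHypergroup := instProd
  conv_comm p q := by
    change radonProd (conv p.1 q.1) (conv p.2 q.2) = radonProd (conv q.1 p.1) (conv q.2 p.2)
    congr 1
    · exact CommHypergroup.conv_comm _ _
    · exact CommHypergroup.conv_comm _ _

end Product

/-! ### Characters, Haar measures and `α`-amenability -/

section Dual

/-- The dual `K̂`: continuous bounded functions `α ≠ 0` with `ω(x, y)(α) = α(x) α(y)` and
`α(x̃) = conj α(x)`, as a subspace of `C(K, ℂ)` with the compact-open topology. -/
abbrev Dual (K : Type*) [TopologicalSpace K] [MeasurableSpace K] [Hypergroup K] : Type _ :=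
  {α : C(K, ℂ) // α ≠ 0 ∧ (∃ C : ℝ, ∀ x, ‖α x‖ ≤ C) ∧
    (∀ x y, ∫ t, α t ∂(conv x y) = α x * α y) ∧ ∀ x, α (inv x) = conj (α x)}

variable {K : Type*} [TopologicalSpace K] [T2Space K] [LocallyCompactSpace K]
  [MeasurableSpace K] [BorelSpace K] [Hypergroup K]

/-- The translation `T_x φ(y) = ∫ φ dω(x, y)`. -/
def translate (x : K) (φ : K → ℂ) (y : K) : ℂ := ∫ t, φ t ∂(conv x y)

/-- A (left) Haar measure: a nonzero Radon measure `m` with `∫ T_x f dm = ∫ f dm` for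
`f ∈ C_c(K)`. Radon measures are normalised to be inner regular on all Borel sets, so that locally
null sets are null and `L^∞(m)` is the space of essentially bounded functions modulo locally null
functions; when `K` is `σ`-compact this is no restriction. -/
structure IsHaarMeasure (m : Measure K) : Prop where
  ne_zero : m ≠ 0
  lt_top_of_isCompact : ∀ ⦃C : Set K⦄, IsCompact C → m C < ∞
  innerRegular : m.InnerRegular
  integral_translate : ∀ (x : K) (f : C_c(K, ℝ)),
    ∫ y, ∫ t, f t ∂(conv x y) ∂m = ∫ y, f y ∂m

theorem memLp_top_of_bounded (m : Measure K) {φ : K → ℂ} (hφ : Measurable φ)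
    {C : ℝ} (hC : ∀ t, ‖φ t‖ ≤ C) : MemLp φ ∞ m :=
  memLp_top_of_bound hφ.aestronglyMeasurable C (.of_forall hC)

theorem measurable_translate (x : K) {φ : K → ℂ} (hφ : Measurable φ) :
    Measurable (translate x φ) :=
  (hφ.stronglyMeasurable.integral_kernel (κ := ⟨fun y => conv x y, measurable_conv x⟩)).measurable

theorem norm_translate_le (x : K) {φ : K → ℂ} {C : ℝ} (hC : ∀ t, ‖φ t‖ ≤ C) (y : K) :
    ‖translate x φ y‖ ≤ C := by
  simpa [translate] using norm_integral_le_of_norm_le_const (μ := conv x y) (.of_forall hC)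

/-- The class in `L^∞(K, m)` of a bounded Borel function. -/
def toLinfty (m : Measure K) (φ : K → ℂ) (hφ : Measurable φ) (hb : ∃ C : ℝ, ∀ t, ‖φ t‖ ≤ C) :
    Lp ℂ ∞ m :=
  (memLp_top_of_bounded m hφ hb.choose_spec).toLp φ

/-- `K` is `α`-amenable (with respect to the Haar measure `m` defining `L^∞(K)`): there is a bounded
linear functional `M` on `L^∞(K)` with `M(α) = 1` and `M(T_x φ) = α(x) M(φ)` for all `x ∈ K` and
`φ ∈ L^∞(K)`; elements of `L^∞(K)` are given by bounded Borel representatives `φ`. -/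
def IsAmenableAt (m : Measure K) (α : Dual K) : Prop :=
  ∃ M : StrongDual ℂ (Lp ℂ ∞ m),
    M (toLinfty m α.1 α.1.continuous.measurable α.2.2.1) = 1 ∧
    ∀ (x : K) (φ : K → ℂ) (hφ : Measurable φ) (hb : ∃ C : ℝ, ∀ t, ‖φ t‖ ≤ C),
      M (toLinfty m (translate x φ) (measurable_translate x hφ)
        (hb.imp fun _ hC => norm_translate_le x hC)) = α.1 x * M (toLinfty m φ hφ hb)

end Dual

section Tensor

variable {K H : Type*} [TopologicalSpace K] [T2Space K] [LocallyCompactSpace K]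
  [MeasurableSpace K] [BorelSpace K] [TopologicalSpace H] [T2Space H] [LocallyCompactSpace H]
  [MeasurableSpace H] [BorelSpace H] [MeasurableSpace (K × H)] [BorelSpace (K × H)]
  [Hypergroup K] [Hypergroup H]

theorem integral_tensor_real (x y : K) (x' y' : H) {u : K → ℝ} {v : H → ℝ} (hu : Continuous u)
    (hv : Continuous v) :
    ∫ p, u p.1 * v p.2 ∂(radonProd (conv x y) (conv x' y')) =
      (∫ s, u s ∂(conv x y)) * ∫ t, v t ∂(conv x' y') := by
  rw [integral_prodConv _ _ _ _ (by fun_prop)]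
  simp only [integral_const_mul, integral_mul_const]

theorem integral_tensor (x y : K) (x' y' : H) {u : K → ℂ} {v : H → ℂ} (hu : Continuous u)
    (hv : Continuous v) :
    ∫ p, u p.1 * v p.2 ∂(conv (x, x') (y, y')) =
      (∫ s, u s ∂(conv x y)) * ∫ t, v t ∂(conv x' y') := by
  have hu1 : Continuous fun s => (u s).re := Complex.continuous_re.comp hu
  have hu2 : Continuous fun s => (u s).im := Complex.continuous_im.comp hu
  have hv1 : Continuous fun s => (v s).re := Complex.continuous_re.comp hv
  have hv2 : Continuous fun s => (v s).im := Complex.continuous_im.comp hv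
  have hI : ∀ {a : K → ℝ} {b : H → ℝ}, Continuous a → Continuous b →
      Integrable (fun p : K × H => a p.1 * b p.2) (conv (x, x') (y, y')) := fun ha hb =>
    integrable_conv _ _ (by fun_prop)
  have hT : ∀ {a : K → ℝ} {b : H → ℝ}, Continuous a → Continuous b →
      ∫ p : K × H, a p.1 * b p.2 ∂(conv (x, x') (y, y')) =
        (∫ s, a s ∂(conv x y)) * ∫ t, b t ∂(conv x' y') := fun ha hb =>
    integral_tensor_real x y x' y' ha hb
  have hiu := integrable_conv x y hu
  have hiv := integrable_conv x' y' hv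
  have hiuv := integrable_conv (x, x') (y, y') (f := fun p : K × H => u p.1 * v p.2) (by fun_prop)
  have e1 := integral_re_add_im hiu
  have e2 := integral_re_add_im hiv
  have e3 := integral_re_add_im hiuv
  simp only [RCLike.re_eq_complex_re, RCLike.im_eq_complex_im, Complex.mul_re, Complex.mul_im,
    RCLike.I_to_complex, Complex.coe_algebraMap] at e1 e2 e3
  rw [integral_sub (hI hu1 hv1) (hI hu2 hv2), integral_add (hI hu1 hv2) (hI hu2 hv1),
    hT hu1 hv1, hT hu2 hv2, hT hu1 hv2, hT hu2 hv1] at e3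
  rw [← e1, ← e2, ← e3]
  apply Complex.ext <;> simp

/-- The character `(α ⊗ β)(x, y) = α(x) β(y)` of `K × H`. -/
def tensor (α : Dual K) (β : Dual H) : Dual (K × H) :=
  ⟨⟨fun p => α.1 p.1 * β.1 p.2, by fun_prop⟩, by
    obtain ⟨α, hα, ⟨A, hA⟩, hα', hα''⟩ := α
    obtain ⟨β, hβ, ⟨B, hB⟩, hβ', hβ''⟩ := β
    refine ⟨?_, ⟨A * B, ?_⟩, ?_, ?_⟩
    · obtain ⟨x, hx⟩ := DFunLike.ne_iff.mp hα
      obtain ⟨y, hy⟩ := DFunLike.ne_iff.mp hβ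
      exact DFunLike.ne_iff.mpr ⟨(x, y), mul_ne_zero hx hy⟩
    · intro p
      change ‖α p.1 * β p.2‖ ≤ A * B
      rw [norm_mul]
      exact mul_le_mul (hA _) (hB _) (norm_nonneg _) ((norm_nonneg _).trans (hA p.1))
    · rintro ⟨x, x'⟩ ⟨y, y'⟩
      change ∫ p : K × H, α p.1 * β p.2 ∂(conv (x, x') (y, y')) = α x * β x' * (α y * β y')
      rw [integral_tensor x y x' y' α.continuous β.continuous, hα', hβ']
      ring
    · rintro ⟨x, x'⟩
      change α (inv x) * β (inv x') = conj (α x * β x')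
      rw [hα'', hβ'', map_mul]⟩

end Tensor

end Hypergroup

end

noncomputable section

namespace Hypergroup

/-! ### Supports of convolutions and translates of compactly supported functions -/

section Topology

variable {K : Type*} [TopologicalSpace K] [T2Space K] [LocallyCompactSpace K]
  [MeasurableSpace K] [BorelSpace K] [Hypergroup K]

/-! For (i), `δ_(x,e) * δ_(e,y) = δ_(x,y)`, so every character factors as `γ(x,y) = γ(x,e) γ(e,y)`
(`Dual.apply_prod`). Restriction to the two axes therefore inverts `tensor`. Both maps are built
from products and precompositions with continuous maps, which are continuous for the compact-open
topology.

For (ii), the natural constructions are `f ↦ M(f ⊗ β)` and, conversely, `f ↦ N(x ↦ N'(f(x,·)))`.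
Slices make no sense for classes in `L^∞(K × H)`, so everything is transferred to bounded continuous
functions. An invariant functional on `L^∞` restricts to them. In the other direction one smooths:
for `F ∈ C_c` let `smooth F φ (x) = ∫ φ T_x̃F dm`. This maps `L^∞` boundedly into the bounded
continuous functions, commutes with translations, and multiplies a character `γ` by the constant `∫
F γ dm`, which is nonzero for a suitable bump `F` at `e`. Composing with it turns an invariant
functional on any space of continuous functions containing all smoothings into one on `L^∞`
(`IsHaarMeasure.isAmenableAt_of_functional`).

The smoothing identities rest on `T_x̃` being the adjoint of `T_x` with respect to Haar measure. For
functions in `C_c` this follows by testing against an approximate identity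
(`IsHaarMeasure.integral_ccTranslate_mul`). It extends to bounded Borel functions by a monotone
convergence theorem for nets of lower semicontinuous functions
(`IsHaarMeasure.bind_conv_withDensity`).

The iterated functional needs `x ↦ N'(f(x,·))` to be continuous, which can be guaranteed when the
slices of `f` vary norm continuously. Smoothings have this property: `T_(e,ỹ)` contracts the `L¹`
norm, so the modulus of continuity in `x` does not depend on `y`
(`IsHaarMeasure.norm_smooth_sub_le`). -/

theorem continuous_integral_conv_complex {P : Type*} [TopologicalSpace P] {a b : P → K}
    (ha : Continuous a) (hb : Continuous b) {G : P → K → ℂ} (hG : Continuous G.uncurry) :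
    Continuous fun p => ∫ s, G p s ∂(conv (a p) (b p)) := by
  have key : ∀ p, ∫ s, G p s ∂(conv (a p) (b p)) =
      ((∫ s, (G p s).re ∂(conv (a p) (b p)) : ℝ) : ℂ) +
        ((∫ s, (G p s).im ∂(conv (a p) (b p)) : ℝ) : ℂ) * Complex.I := fun p =>
    (integral_re_add_im (integrable_conv (a p) (b p) (hG.comp (Continuous.prodMk_right p)))).symm
  simp_rw [key]
  have h1 := continuous_integral_conv ha hb (G := fun p s => (G p s).re)
    (Complex.continuous_re.comp hG)
  have h2 := continuous_integral_conv ha hb (G := fun p s => (G p s).im)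
    (Complex.continuous_im.comp hG)
  fun_prop

theorem integral_conv_e {E : Type*} [NormedAddCommGroup E] [NormedSpace ℝ E] [CompleteSpace E]
    (x : K) (f : K → E)
    (hf : StronglyMeasurable f) : ∫ t, f t ∂(conv x e) = f x := by
  rw [conv_e, integral_dirac' f x hf]

theorem ae_notMem_of_disjoint_support {x y : K} {U : Set K}
    (h : Disjoint (conv x y).support U) : ∀ᵐ t ∂(conv x y), t ∉ U := by
  filter_upwards [ae_mem_support (conv x y)] with t ht using disjoint_left.mp h ht

/-- If `z` lies in no support `supp ω(u, y)` with `(u, y)` in a compact set, then a whole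
neighbourhood of `z` is disjoint from these supports. -/
theorem exists_isOpen_disjoint_support {Q : Set (K × K)} (hQ : IsCompact Q) {z : K}
    (h : ∀ p ∈ Q, z ∉ (conv p.1 p.2).support) :
    ∃ U : Set K, IsOpen U ∧ z ∈ U ∧ ∀ p ∈ Q, Disjoint (conv p.1 p.2).support U := by
  -- Phrased with small sets, the property is stable under finite unions of `Q`, so by compactness
  -- it only has to be checked near each point of `Q`.
  have key : ∀ᶠ t in (𝓝 z).smallSets, ∀ p ∈ Q, Disjoint (conv p.1 p.2).support t := by
    refine hQ.induction_on (p := fun Q => ∀ᶠ t in (𝓝 z).smallSets, ∀ p ∈ Q,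
      Disjoint (conv p.1 p.2).support t) (by simp) (fun s t hst ht => ?_) (fun s t hs ht => ?_) ?_
    · filter_upwards [ht] with U hU p hp using hU p (hst hp)
    · filter_upwards [hs, ht] with U hU hU' p hp using hp.elim (hU p) (hU' p)
    · intro p hp
      obtain ⟨V, U, hV, hU, hsV, hzU, hVU⟩ :=
        SeparatedNhds.of_isCompact_isCompact (isCompact_support_conv p.1 p.2)
          (isCompact_singleton (x := z)) (disjoint_singleton_right.mpr (h p hp))
      have hev := eventually_support_subset continuous_fst continuous_snd p hV hsV
      refine ⟨_, mem_nhdsWithin_of_mem_nhds hev, ?_⟩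
      refine (eventually_smallSets_forall.mpr (hU.mem_nhds (hzU rfl))).mono ?_
      intro W hW p hp
      refine (hVU.mono_left hp).mono_right fun w hw => hW w hw
  obtain ⟨t, ht, h⟩ := eventually_smallSets.mp key
  obtain ⟨U, hUt, hU, hzU⟩ := mem_nhds_iff.mp ht
  exact ⟨U, hU, hzU, h U hUt⟩

/-- The supports over `C × D` form a compact family in the Vietoris topology, and the union of a
compact family of compact sets is compact. -/
theorem exists_isCompact_support_subset {C D : Set K} (hC : IsCompact C) (hD : IsCompact D) :
    ∃ E : Set K, IsCompact E ∧ ∀ x ∈ C, ∀ y ∈ D, (conv x y).support ⊆ E := by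
  have h := TopologicalSpace.Compacts.isCompact_biUnion_coe_of_isCompact
    ((hC.prod hD).image (continuous_support_conv (K := K)))
  refine ⟨_, h, fun x hx y hy t ht => ?_⟩
  simp only [mem_iUnion]
  exact ⟨_, ⟨(x, y), ⟨hx, hy⟩, rfl⟩, ht⟩

theorem integral_conv_pos {x y t : K} (ht : t ∈ (conv x y).support) {f : K → ℝ}
    (hf : Continuous f) (h0 : ∀ s, 0 ≤ f s) (hpos : 0 < f t) : 0 < ∫ s, f s ∂(conv x y) := by
  rw [integral_pos_iff_support_of_nonneg h0 (integrable_conv x y hf)]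
  exact (Measure.mem_support_iff_forall t).mp ht _ (hf.isOpen_support.mem_nhds hpos.ne')

theorem conv_assoc_cc (x y z : K) (f : C_c(K, ℝ)) :
    ∫ t, ∫ s, f s ∂(conv t z) ∂(conv x y) = ∫ t, ∫ s, f s ∂(conv x t) ∂(conv y z) :=
  conv_assoc x y z (f : K →ᵇ ℝ)

/-- By associativity `t̃ * (u * y) = (t̃ * u) * y`. The left side charges every neighbourhood of
`e`, since `t ∈ supp(u * y)` and `e ∈ supp(t̃ * t)`. If `ỹ` were outside `supp(t̃ * u)`, then no
`supp(r * y)` with `r ∈ supp(t̃ * u)` would contain `e`, and the right side would miss a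
neighbourhood of `e`. Applying the involution to `ỹ ∈ supp(t̃ * u)` gives the claim. -/
theorem mem_support_inv_conv {u y t : K} (ht : t ∈ (conv u y).support) :
    y ∈ (conv (inv u) t).support := by
  have hsymm : ∀ a b : K, ∀ s, s ∈ (conv a b).support → inv s ∈ (conv (inv b) (inv a)).support := by
    intro a b s hs
    rw [← map_inv_conv]
    by_contra hcon
    rw [Measure.notMem_support_iff_exists] at hcon
    obtain ⟨U, hU, h0⟩ := hcon
    obtain ⟨V, hVU, hV, hsV⟩ := mem_nhds_iff.mp hU
    have h1 : (conv a b) (inv ⁻¹' V) = 0 := by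
      rw [← Measure.map_apply continuous_inv.measurable hV.measurableSet]
      exact measure_mono_null hVU h0
    exact ((Measure.mem_support_iff_forall s).mp hs _
      ((hV.preimage continuous_inv).mem_nhds hsV)).ne' h1
  suffices h : inv y ∈ (conv (inv t) u).support by
    have := hsymm _ _ _ h
    rwa [inv_inv, inv_inv] at this
  by_contra hcon
  obtain ⟨U, hU, heU, hdisj⟩ := exists_isOpen_disjoint_support
    (Q := (conv (inv t) u).support ×ˢ {y}) ((isCompact_support_conv _ _).prod isCompact_singleton)
    (z := e) (by
      rintro ⟨r, y'⟩ ⟨hr, rfl⟩ he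
      rw [e_mem_support_conv_iff] at he
      exact hcon (he ▸ hr))
  obtain ⟨f, f1, f2, f3⟩ := exists_cutoff isCompact_singleton hU (singleton_subset_iff.mpr heU)
  have h0 : ∫ r, ∫ s, f s ∂(conv r y) ∂(conv (inv t) u) = 0 := by
    refine integral_eq_zero_of_ae ?_
    filter_upwards [ae_mem_support (conv (inv t) u)] with r hr
    refine integral_eq_zero_of_ae ?_
    filter_upwards [ae_notMem_of_disjoint_support (hdisj (r, y) ⟨hr, rfl⟩)] with s hs
    exact f2 s hs
  rw [conv_assoc_cc] at h0
  refine (integral_conv_pos ht (f := fun r => ∫ s, f s ∂(conv (inv t) r)) ?_ ?_ ?_).ne' h0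
  · exact continuous_integral_conv continuous_const continuous_id (G := fun _ s => f s)
      (f.continuous.comp continuous_snd)
  · exact fun r => integral_nonneg fun s => (f3 s).1
  · refine integral_conv_pos (t := e) ((e_mem_support_conv_iff _ _).mpr rfl) f.continuous
      (fun s => (f3 s).1) ?_
    rw [f1 e rfl]; exact one_pos

theorem continuous_translate_real {f : K → ℝ} (hf : Continuous f) :
    Continuous fun p : K × K => ∫ s, f s ∂(conv p.1 p.2) :=
  continuous_integral_conv continuous_fst continuous_snd (G := fun _ s => f s)
    (hf.comp continuous_snd)

/-- Translates of a compactly supported function by elements of a compact set are supported in a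
common compact set. -/
theorem exists_isCompact_translate_eq_zero {C S : Set K} (hC : IsCompact C) (hS : IsCompact S) :
    ∃ D : Set K, IsCompact D ∧ ∀ f : K → ℝ, (∀ t ∉ S, f t = 0) → ∀ u ∈ C, ∀ y ∉ D,
      ∫ t, f t ∂(conv u y) = 0 := by
  obtain ⟨D, hD, hsub⟩ := exists_isCompact_support_subset (hC.image continuous_inv) hS
  refine ⟨D, hD, fun f hf u hu y hy => integral_eq_zero_of_ae ?_⟩
  filter_upwards [ae_mem_support (conv u y)] with t ht
  by_contra h
  exact hy (hsub _ ⟨u, hu, rfl⟩ t (by_contra fun h' => h (hf t h')) (mem_support_inv_conv ht))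

/-- The translate `T_x f` of a compactly supported function. -/
def ccTranslate (x : K) (f : C_c(K, ℝ)) : C_c(K, ℝ) :=
  ⟨⟨fun y => ∫ t, f t ∂(conv x y),
    (continuous_translate_real f.continuous).comp (Continuous.prodMk_right x)⟩, by
    obtain ⟨D, hD, h⟩ := exists_isCompact_translate_eq_zero (isCompact_singleton (x := x))
      f.hasCompactSupport.isCompact
    exact HasCompactSupport.intro hD fun y hy =>
      h f (fun t ht => image_eq_zero_of_notMem_tsupport ht) x rfl y hy⟩

theorem ccTranslate_apply (x : K) (f : C_c(K, ℝ)) (y : K) :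
    ccTranslate x f y = ∫ t, f t ∂(conv x y) := rfl

theorem continuous_ccTranslate (f : C_c(K, ℝ)) :
    Continuous fun p : K × K => ccTranslate p.1 f p.2 :=
  continuous_translate_real f.continuous

theorem exists_isCompact_ccTranslate_eq_zero {C : Set K} (hC : IsCompact C) (f : C_c(K, ℝ)) :
    ∃ D : Set K, IsCompact D ∧ ∀ u ∈ C, ∀ y ∉ D, ccTranslate u f y = 0 := by
  obtain ⟨D, hD, h⟩ := exists_isCompact_translate_eq_zero hC f.hasCompactSupport.isCompact
  exact ⟨D, hD, fun u hu y hy => h f (fun t ht => image_eq_zero_of_notMem_tsupport ht) u hu y hy⟩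

theorem ccTranslate_nonneg {f : C_c(K, ℝ)} (hf : ∀ t, 0 ≤ f t) (x y : K) :
    0 ≤ ccTranslate x f y :=
  integral_nonneg hf

/-- If `ω(u, y)` charges a small neighbourhood of `e`, then `y` is close to `ũ`. -/
theorem exists_isOpen_dist_lt {f : K → ℝ} (hf : Continuous f) {E : Set K} (hE : IsCompact E)
    {ε : ℝ} (hε : 0 < ε) :
    ∃ U : Set K, IsOpen U ∧ e ∈ U ∧ ∀ u ∈ E, ∀ y, ¬ Disjoint (conv u y).support U →
      |f y - f (inv u)| ≤ ε := by
  -- If `supp ω(u, y)` meets `W` with `u ∈ E`, then `y` lies in the compact set `D`. So only a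
  -- compact set of bad pairs, those with `|f y - f ũ| ≥ ε`, has to be avoided; none of their
  -- supports contains `e`, as that would force `u = ỹ`.
  obtain ⟨W, hW, heW⟩ := exists_compact_mem_nhds (e : K)
  obtain ⟨D, hD, hsub⟩ := exists_isCompact_support_subset (hE.image continuous_inv) hW
  have hcont : Continuous fun p : K × K => |f p.2 - f (inv p.1)| :=
    ((hf.comp continuous_snd).sub (hf.comp (continuous_inv.comp continuous_fst))).abs
  obtain ⟨U, hU, heU, hdisj⟩ := exists_isOpen_disjoint_support (z := (e : K))
    ((hE.prod hD).inter_right (isClosed_le continuous_const hcont : IsClosed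
      {p : K × K | ε ≤ |f p.2 - f (inv p.1)|})) (by
      rintro ⟨u, y⟩ ⟨-, hp⟩ he
      rw [e_mem_support_conv_iff] at he
      obtain rfl : u = inv y := he
      change ε ≤ |f y - f (inv (inv y))| at hp
      rw [inv_inv, sub_self, abs_zero] at hp
      exact hp.not_gt hε)
  refine ⟨U ∩ interior W, hU.inter isOpen_interior, ⟨heU, mem_interior_iff_mem_nhds.mpr heW⟩,
    fun u hu y hy => ?_⟩
  obtain ⟨t, ht, htU, htW⟩ := not_disjoint_iff.mp hy
  by_contra! hlt
  have hyD : y ∈ D := hsub _ ⟨u, hu, rfl⟩ t (interior_subset htW) (mem_support_inv_conv ht)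
  exact disjoint_left.mp (hdisj (u, y) ⟨⟨hu, hyD⟩, hlt.le⟩) ht htU

theorem inv_e : inv (e : K) = e := by
  have h : (e : K) ∈ (conv e e).support := by
    rw [Measure.mem_support_iff_forall]
    intro U hU
    rw [e_conv, Measure.dirac_apply_of_mem (mem_of_mem_nhds hU)]
    exact one_pos
  exact ((e_mem_support_conv_iff e e).mp h).symm

/-- A nonnegative symmetric bump function at `e`. -/
theorem exists_symmetric_bump {U : Set K} (hU : IsOpen U) (he : e ∈ U) :
    ∃ k : C_c(K, ℝ), (∀ t, 0 ≤ k t) ∧ (∀ t ∉ U, k t = 0) ∧ 0 < k e ∧ ∀ t, k (inv t) = k t := by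
  obtain ⟨f, f1, f2, f3⟩ := exists_cutoff isCompact_singleton hU (singleton_subset_iff.mpr he)
  -- Symmetrising by a product rather than a sum keeps the support condition without assuming `U`
  -- symmetric.
  refine ⟨⟨⟨fun t => f t * f (inv t), f.continuous.mul (f.continuous.comp continuous_inv)⟩,
    f.hasCompactSupport.mul_right⟩, fun t => mul_nonneg (f3 _).1 (f3 _).1, fun t ht => ?_, ?_,
    fun t => ?_⟩
  · change f t * f (inv t) = 0
    rw [f2 t ht, zero_mul]
  · change 0 < f e * f (inv e)
    rw [inv_e, f1 e rfl]; norm_num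
  · change f (inv t) * f (inv (inv t)) = f t * f (inv t)
    rw [inv_inv, mul_comm]

end Topology

/-- Fubini without σ-finiteness of `ν`: a cutoff equal to 1 on `supp μ × D` reduces to a compactly
supported integrand without changing either iterated integral. -/
theorem integral_swap_of_compact {X Y : Type*} [TopologicalSpace X] [T2Space X]
    [LocallyCompactSpace X] [MeasurableSpace X] [BorelSpace X] [TopologicalSpace Y] [T2Space Y]
    [LocallyCompactSpace Y] [MeasurableSpace Y] [BorelSpace Y] (μ : Measure X) (ν : Measure Y)
    [μ.Regular] [IsFiniteMeasureOnCompacts ν] (hμ : IsCompact μ.support) {f : X → Y → ℝ}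
    (hf : Continuous f.uncurry) {D : Set Y} (hD : IsCompact D)
    (h0 : ∀ x ∈ μ.support, ∀ y ∉ D, f x y = 0) :
    ∫ x, ∫ y, f x y ∂ν ∂μ = ∫ y, ∫ x, f x y ∂μ ∂ν := by
  obtain ⟨g, g1, -, -⟩ := exists_cutoff (hμ.prod hD) isOpen_univ (subset_univ _)
  have key := integral_integral_swap_of_hasCompactSupport (f := fun x y => f x y * g (x, y))
    (μ := μ) (ν := ν) (by
      change Continuous fun p : X × Y => f.uncurry p * g p
      fun_prop) (by
      change HasCompactSupport fun p : X × Y => f.uncurry p * g p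
      exact g.hasCompactSupport.mul_left)
  have hfg : ∀ x ∈ μ.support, ∀ y, f x y * g (x, y) = f x y := by
    intro x hx y
    by_cases hy : y ∈ D
    · rw [g1 _ ⟨hx, hy⟩, mul_one]
    · rw [h0 x hx y hy, zero_mul]
  convert key using 1
  · refine integral_congr_ae ?_
    filter_upwards [ae_mem_support μ] with x hx
    exact integral_congr_ae (.of_forall fun y => (hfg x hx y).symm)
  · refine integral_congr_ae (.of_forall fun y => integral_congr_ae ?_)
    filter_upwards [ae_mem_support μ] with x hx using (hfg x hx y).symm

/-! ### Haar measure and the adjoint of a translation on `C_c` -/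

section Haar

variable {K : Type*} [TopologicalSpace K] [T2Space K] [LocallyCompactSpace K]
  [MeasurableSpace K] [BorelSpace K]

theorem IsHaarMeasure.isFiniteMeasureOnCompacts [Hypergroup K] {m : Measure K}
    (hm : IsHaarMeasure m) : IsFiniteMeasureOnCompacts m :=
  ⟨fun _ hC => hm.lt_top_of_isCompact hC⟩

theorem integrable_cc (m : Measure K) [IsFiniteMeasureOnCompacts m] (f : C_c(K, ℝ)) :
    Integrable f m := (map_continuous f).integrable_of_hasCompactSupport f.hasCompactSupport

theorem IsHaarMeasure.integral_ccTranslate [Hypergroup K] {m : Measure K} (hm : IsHaarMeasure m)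
    (x : K) (f : C_c(K, ℝ)) : ∫ y, ccTranslate x f y ∂m = ∫ y, f y ∂m :=
  hm.integral_translate x f

variable [CommHypergroup K]

theorem ccTranslate_swap (x y : K) (f : C_c(K, ℝ)) : ccTranslate x f y = ccTranslate y f x := by
  rw [ccTranslate_apply, ccTranslate_apply, CommHypergroup.conv_comm]

/-- Associativity alone would give `ω(y, x)` on the right; commutativity turns it into `ω(x, y)`. -/
theorem ccTranslate_ccTranslate (x y z : K) (f : C_c(K, ℝ)) :
    ccTranslate x (ccTranslate y f) z = ∫ t, ccTranslate t f z ∂(conv x y) := by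
  rw [CommHypergroup.conv_comm x y]
  exact (conv_assoc_cc y x z f).symm

/-- The involution carries `ω(x̃, y)` to `ω(ỹ, x)`, so a symmetric `k` gives a symmetric kernel. -/
theorem ccTranslate_inv_swap {k : C_c(K, ℝ)} (hk : ∀ t, k (inv t) = k t) (x y : K) :
    ccTranslate (inv x) k y = ccTranslate (inv y) k x := by
  have h := integral_comp_inv (inv x) y (map_continuous k)
  simp only [hk, inv_inv] at h
  exact h

/-- If `k ≥ 0` is supported near `e`, then `T_u k · m` is nearly `(∫ k dm) δ_ũ`. -/
theorem IsHaarMeasure.exists_isOpen_integral_ccTranslate_mul {m : Measure K}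
    (hm : IsHaarMeasure m) (f : C_c(K, ℝ)) {E : Set K} (hE : IsCompact E) {ε : ℝ} (hε : 0 < ε) :
    ∃ U : Set K, IsOpen U ∧ e ∈ U ∧ ∀ k : C_c(K, ℝ), (∀ t, 0 ≤ k t) → (∀ t ∉ U, k t = 0) →
      ∀ u ∈ E, |∫ y, f y * ccTranslate u k y ∂m - f (inv u) * ∫ y, k y ∂m| ≤ ε * ∫ y, k y ∂m := by
  have := hm.isFiniteMeasureOnCompacts
  obtain ⟨U, hU, heU, h⟩ := exists_isOpen_dist_lt (map_continuous f) hE hε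
  refine ⟨U, hU, heU, fun k hk0 hkU u hu => ?_⟩
  have hI := integrable_cc m (ccTranslate u k)
  have hI' : Integrable (fun y => f y * ccTranslate u k y) m :=
    integrable_cc m (f * ccTranslate u k)
  -- Only those `y` for which `supp ω(u, y)` meets `U` contribute to `T_u k`, and there `f` is
  -- within `ε` of `f(ũ)`.
  have hpt : ∀ y, |(f y - f (inv u)) * ccTranslate u k y| ≤ ε * ccTranslate u k y := by
    intro y
    rw [abs_mul, abs_of_nonneg (ccTranslate_nonneg hk0 u y)]
    by_cases hd : Disjoint (conv u y).support U
    · have : ccTranslate u k y = 0 := by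
        refine integral_eq_zero_of_ae ?_
        filter_upwards [ae_notMem_of_disjoint_support hd] with t ht using hkU t ht
      simp [this]
    · exact mul_le_mul_of_nonneg_right (h u hu y hd) (ccTranslate_nonneg hk0 u y)
  have e1 : ∫ y, f y * ccTranslate u k y ∂m - f (inv u) * ∫ y, k y ∂m =
      ∫ y, (f y - f (inv u)) * ccTranslate u k y ∂m := by
    rw [← hm.integral_ccTranslate u k, ← integral_const_mul, ← integral_sub hI' (hI.const_mul _)]
    simp only [sub_mul]
  rw [e1, ← hm.integral_ccTranslate u k, ← integral_const_mul, ← Real.norm_eq_abs]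
  exact norm_integral_le_of_norm_le (hI.const_mul ε) (.of_forall hpt)

/-- If `∫ k dm = 0`, every translate `T_z̃ k` also has integral zero, while it is positive at `z`.
Hence every point has a null neighbourhood, compact sets are null, and inner regularity forces `m =
0`. -/
theorem IsHaarMeasure.integral_pos {m : Measure K} (hm : IsHaarMeasure m) {k : C_c(K, ℝ)}
    (hk : ∀ t, 0 ≤ k t) (hke : 0 < k e) : 0 < ∫ y, k y ∂m := by
  have := hm.isFiniteMeasureOnCompacts
  have := hm.innerRegular
  refine lt_of_le_of_ne (integral_nonneg hk) fun h0 => hm.ne_zero ?_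
  have hloc : ∀ z : K, ∃ t ∈ 𝓝 z, m t = 0 := by
    intro z
    have hz : 0 < ccTranslate (inv z) k z := by
      rw [ccTranslate_swap]
      exact integral_conv_pos (t := e) ((e_mem_support_conv_iff _ _).mpr (inv_inv z).symm)
        (map_continuous k) hk hke
    refine ⟨_, (ccTranslate (inv z) k).continuous.isOpen_support.mem_nhds hz.ne', ?_⟩
    by_contra hne
    have := (integral_pos_iff_support_of_nonneg (ccTranslate_nonneg hk (inv z))
      (integrable_cc m _)).mpr (pos_iff_ne_zero.mpr hne)
    rw [hm.integral_ccTranslate, ← h0] at this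
    exact this.false
  rw [← Measure.measure_univ_eq_zero, MeasurableSet.univ.measure_eq_iSup_isCompact]
  refine le_antisymm (iSup₂_le fun C _ => iSup_le fun hC => ?_) bot_le
  refine (hC.measure_zero_of_nhdsWithin fun z _ => ?_).le
  obtain ⟨t, ht, h⟩ := hloc z
  exact ⟨t, mem_nhdsWithin_of_mem_nhds ht, h⟩

theorem integral_cc_comp_inv (x z : K) (g : C_c(K, ℝ)) :
    ∫ u, g (inv u) ∂(conv x (inv z)) = ccTranslate (inv x) g z := by
  rw [integral_comp_inv x (inv z) (map_continuous g), inv_inv, CommHypergroup.conv_comm]; rfl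

/-- The adjoint of `T_x` is `T_x̃`, for compactly supported functions. -/
theorem IsHaarMeasure.integral_ccTranslate_mul {m : Measure K} (hm : IsHaarMeasure m) (x : K)
    (f g : C_c(K, ℝ)) :
    ∫ y, ccTranslate x f y * g y ∂m = ∫ y, f y * ccTranslate (inv x) g y ∂m := by
  -- For a symmetric bump `k` at `e`, with `I = ∫ k dm`, the double integral of `f(z) g(y) T_x T_z̃
  -- k(y)` is estimated in the two orders. It is close to `A * I` and to `B * I`, with errors `ε * I
  -- * Cg` and `ε * I * Cf`; dividing by `I > 0` gives `|A - B| ≤ (Cf + Cg) * ε < δ`.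
  have := hm.isFiniteMeasureOnCompacts
  set A := ∫ y, ccTranslate x f y * g y ∂m with hA
  set B := ∫ y, f y * ccTranslate (inv x) g y ∂m with hB
  set Cf := ∫ y, |f y| ∂m
  set Cg := ∫ y, |g y| ∂m
  obtain ⟨E₁, hE₁, hs₁⟩ := exists_isCompact_support_subset (isCompact_singleton (x := x))
    g.hasCompactSupport.isCompact
  obtain ⟨E₂, hE₂, hs₂⟩ := exists_isCompact_support_subset (isCompact_singleton (x := x))
    (f.hasCompactSupport.isCompact.image continuous_inv)
  refine eq_of_forall_dist_le fun δ hδ => ?_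
  obtain ⟨ε, hε, hεδ⟩ := exists_pos_mul_lt hδ (Cf + Cg)
  obtain ⟨U₁, hU₁, he₁, h₁⟩ := hm.exists_isOpen_integral_ccTranslate_mul f
    (hE₁.image continuous_inv) hε
  obtain ⟨U₂, hU₂, he₂, h₂⟩ := hm.exists_isOpen_integral_ccTranslate_mul g hE₂ hε
  obtain ⟨k, k0, kU, ke, kinv⟩ := exists_symmetric_bump (hU₁.inter hU₂) ⟨he₁, he₂⟩
  have hI := hm.integral_pos k0 ke
  set I := ∫ y, k y ∂m
  replace h₁ := h₁ k k0 fun t ht => kU t fun h => ht h.1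
  replace h₂ := h₂ k k0 fun t ht => kU t fun h => ht h.2
  have hjoint : Continuous fun p : K × K => ccTranslate x (ccTranslate (inv p.1) k) p.2 :=
    continuous_integral_conv (P := K × K) continuous_const continuous_snd
      (G := fun p t => ccTranslate (inv p.1) k t) ((continuous_ccTranslate k).comp
        ((continuous_inv.comp (continuous_fst.comp continuous_fst)).prodMk continuous_snd))
  -- Integrating over `z` first: `T_x T_z̃ k(y)` is the `ω(x, y)`-average over `t` of `T_z̃ k(t) =
  -- T_t̃ k(z)`, and `∫ f T_t̃ k dm ≈ f(t) I`. The average over `t` produces `T_x f(y) I`.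
  have hQ₁ : |∫ y, g y * ∫ z, f z * ccTranslate x (ccTranslate (inv z) k) y ∂m ∂m - A * I| ≤
      ε * I * Cg := by
    have hinner : ∀ y, ∫ z, f z * ccTranslate x (ccTranslate (inv z) k) y ∂m =
        ∫ t, ∫ z, f z * ccTranslate (inv t) k z ∂m ∂(conv x y) := by
      intro y
      rw [integral_swap_of_compact (conv x y) m (isCompact_support_conv x y)
        (f := fun t z => f z * ccTranslate (inv t) k z) ?_ f.hasCompactSupport.isCompact ?_]
      · refine integral_congr_ae (.of_forall fun z => ?_)
        change f z * ∫ t, ccTranslate (inv z) k t ∂(conv x y) = _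
        rw [← integral_const_mul]
        simp_rw [ccTranslate_inv_swap kinv z]
      · exact ((map_continuous f).comp continuous_snd).mul ((continuous_ccTranslate k).comp
          ((continuous_inv.comp continuous_fst).prodMk continuous_snd))
      · intro t _ z hz
        rw [image_eq_zero_of_notMem_tsupport hz, zero_mul]
    have hcont : Continuous fun t => ∫ z, f z * ccTranslate (inv t) k z ∂m := by
      rw [← continuousOn_univ]
      refine continuousOn_integral_of_compact_support
        (f := fun t z => f z * ccTranslate (inv t) k z) f.hasCompactSupport.isCompact ?_ ?_
      · exact (((map_continuous f).comp continuous_snd).mul ((continuous_ccTranslate k).comp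
          ((continuous_inv.comp continuous_fst).prodMk continuous_snd))).continuousOn
      · intro t z _ hz
        rw [image_eq_zero_of_notMem_tsupport hz, zero_mul]
    have hcont' : Continuous fun y => ∫ t, ∫ z, f z * ccTranslate (inv t) k z ∂m ∂(conv x y) :=
      (continuous_translate_real hcont).comp (Continuous.prodMk_right x)
    have hpt : ∀ y, |g y * (∫ t, ∫ z, f z * ccTranslate (inv t) k z ∂m ∂(conv x y)) -
        ccTranslate x f y * g y * I| ≤ ε * I * |g y| := by
      intro y
      by_cases hy : y ∈ tsupport g
      swap
      · simp [image_eq_zero_of_notMem_tsupport hy]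
      have h3 : |∫ t, ∫ z, f z * ccTranslate (inv t) k z ∂m ∂(conv x y) -
          ccTranslate x f y * I| ≤ ε * I := by
        rw [ccTranslate_apply, ← integral_mul_const, ← integral_sub (integrable_conv x y hcont)
          ((integrable_conv x y (map_continuous f)).mul_const I), ← Real.norm_eq_abs]
        have := norm_integral_le_of_norm_le_const (μ := conv x y) (C := ε * I)
          (f := fun t => ∫ z, f z * ccTranslate (inv t) k z ∂m - f t * I) (by
            filter_upwards [ae_mem_support (conv x y)] with t ht
            have := h₁ (inv t) ⟨t, hs₁ x rfl y hy ht, rfl⟩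
            rwa [inv_inv] at this)
        simpa using this
      calc _ = |∫ t, ∫ z, f z * ccTranslate (inv t) k z ∂m ∂(conv x y) -
          ccTranslate x f y * I| * |g y| := by rw [← abs_mul]; ring_nf
        _ ≤ _ := mul_le_mul_of_nonneg_right h3 (abs_nonneg _)
    simp_rw [hinner]
    rw [hA, ← integral_mul_const, ← integral_sub, ← integral_const_mul, ← Real.norm_eq_abs]
    · exact norm_integral_le_of_norm_le ((integrable_cc m g).abs.const_mul _) (.of_forall hpt)
    · exact ((map_continuous g).mul hcont').integrable_of_hasCompactSupport g.hasCompactSupport.mul_right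
    · exact (integrable_cc m (ccTranslate x f * g)).mul_const I
  -- Integrating over `y` first: `T_x T_z̃ k` is the `ω(x, z̃)`-average over `u` of `T_u k`, and `∫
  -- g T_u k dm ≈ g(ũ) I`. Averaging `g(ũ)` over `u` produces `T_x̃ g(z)`.
  have hQ₂ : |∫ z, f z * ∫ y, g y * ccTranslate x (ccTranslate (inv z) k) y ∂m ∂m - B * I| ≤
      ε * I * Cf := by
    have hinner : ∀ z, ∫ y, g y * ccTranslate x (ccTranslate (inv z) k) y ∂m =
        ∫ u, ∫ y, g y * ccTranslate u k y ∂m ∂(conv x (inv z)) := by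
      intro z
      rw [integral_swap_of_compact (conv x (inv z)) m (isCompact_support_conv _ _)
        (f := fun u y => g y * ccTranslate u k y) ?_ g.hasCompactSupport.isCompact ?_]
      · refine integral_congr_ae (.of_forall fun y => ?_)
        change g y * _ = _
        rw [ccTranslate_ccTranslate, ← integral_const_mul]
      · exact ((map_continuous g).comp continuous_snd).mul (continuous_ccTranslate k)
      · intro t _ z hz
        rw [image_eq_zero_of_notMem_tsupport hz, zero_mul]
    have hcont : Continuous fun u => ∫ y, g y * ccTranslate u k y ∂m := by
      rw [← continuousOn_univ]
      refine continuousOn_integral_of_compact_support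
        (f := fun u y => g y * ccTranslate u k y) g.hasCompactSupport.isCompact ?_ ?_
      · exact (((map_continuous g).comp continuous_snd).mul (continuous_ccTranslate k)).continuousOn
      · intro t z _ hz
        rw [image_eq_zero_of_notMem_tsupport hz, zero_mul]
    have hcont' : Continuous fun z => ∫ u, ∫ y, g y * ccTranslate u k y ∂m ∂(conv x (inv z)) :=
      (continuous_translate_real hcont).comp (continuous_const.prodMk continuous_inv)
    have hpt : ∀ z, |f z * (∫ u, ∫ y, g y * ccTranslate u k y ∂m ∂(conv x (inv z))) -
        f z * ccTranslate (inv x) g z * I| ≤ ε * I * |f z| := by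
      intro z
      by_cases hz : z ∈ tsupport f
      swap
      · simp [image_eq_zero_of_notMem_tsupport hz]
      have h3 : |∫ u, ∫ y, g y * ccTranslate u k y ∂m ∂(conv x (inv z)) -
          ccTranslate (inv x) g z * I| ≤ ε * I := by
        rw [← integral_cc_comp_inv, ← integral_mul_const,
          ← integral_sub (integrable_conv _ _ hcont)
          ((integrable_conv _ _ (f := fun s => g (inv s))
            ((map_continuous g).comp continuous_inv)).mul_const I),
          ← Real.norm_eq_abs]
        have := norm_integral_le_of_norm_le_const (μ := conv x (inv z)) (C := ε * I)
          (f := fun u => ∫ y, g y * ccTranslate u k y ∂m - g (inv u) * I) (by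
            filter_upwards [ae_mem_support (conv x (inv z))] with u hu
            exact h₂ u (hs₂ x rfl (inv z) ⟨z, hz, rfl⟩ hu))
        simpa using this
      calc _ = |∫ u, ∫ y, g y * ccTranslate u k y ∂m ∂(conv x (inv z)) -
          ccTranslate (inv x) g z * I| * |f z| := by rw [← abs_mul]; ring_nf
        _ ≤ _ := mul_le_mul_of_nonneg_right h3 (abs_nonneg _)
    simp_rw [hinner]
    rw [hB, ← integral_mul_const, ← integral_sub, ← integral_const_mul, ← Real.norm_eq_abs]
    · exact norm_integral_le_of_norm_le ((integrable_cc m f).abs.const_mul _) (.of_forall hpt)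
    · exact ((map_continuous f).mul hcont').integrable_of_hasCompactSupport f.hasCompactSupport.mul_right
    · exact (integrable_cc m (f * ccTranslate (inv x) g)).mul_const I
  have hswap : ∫ y, g y * ∫ z, f z * ccTranslate x (ccTranslate (inv z) k) y ∂m ∂m =
      ∫ z, f z * ∫ y, g y * ccTranslate x (ccTranslate (inv z) k) y ∂m ∂m := by
    simp_rw [← integral_const_mul]
    rw [integral_integral_swap_of_hasCompactSupport]
    · refine integral_congr_ae (.of_forall fun z => integral_congr_ae (.of_forall fun y => ?_))
      ring
    · exact ((map_continuous g).comp continuous_fst).mul (((map_continuous f).comp continuous_snd).mul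
        (hjoint.comp continuous_swap))
    · refine HasCompactSupport.intro
        (g.hasCompactSupport.isCompact.prod f.hasCompactSupport.isCompact) ?_
      rintro ⟨y, z⟩ hyz
      change g y * (f z * _) = 0
      by_cases hy : y ∈ tsupport g
      · rw [image_eq_zero_of_notMem_tsupport fun hz => hyz ⟨hy, hz⟩]; ring
      · rw [image_eq_zero_of_notMem_tsupport hy]; ring
  rw [hswap] at hQ₁
  have hfin : |A - B| * I ≤ ((Cf + Cg) * ε) * I := by
    rw [← abs_of_pos hI, ← abs_mul, abs_of_pos hI]
    calc |(A - B) * I| = |(∫ z, f z * ∫ y, g y * ccTranslate x (ccTranslate (inv z) k) y ∂m ∂m -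
          B * I) - (∫ z, f z * ∫ y, g y * ccTranslate x (ccTranslate (inv z) k) y ∂m ∂m -
          A * I)| := by ring_nf
      _ ≤ ε * I * Cf + ε * I * Cg := (abs_sub _ _).trans (add_le_add hQ₂ hQ₁)
      _ = _ := by ring
  rw [Real.dist_eq]
  exact (le_of_mul_le_mul_right hfin hI).trans hεδ.le

end Haar

/-- Directed suprema of lower semicontinuous functions commute with integrals against finite
measures that are inner regular. -/
theorem lintegral_iSup_of_directed_lowerSemicontinuous {X ι : Type*} [TopologicalSpace X]
    [MeasurableSpace X] [OpensMeasurableSpace X] [Nonempty ι] (ν : Measure X) [IsFiniteMeasure ν]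
    (hν : ∀ A, MeasurableSet A → ν A ≠ 0 → ∃ C ⊆ A, IsCompact C ∧ ν C ≠ 0)
    (f : ι → X → ℝ≥0∞) (hf : ∀ i, LowerSemicontinuous (f i)) (hd : Directed (· ≤ ·) f) :
    ∫⁻ x, ⨆ i, f i x ∂ν = ⨆ i, ∫⁻ x, f i x ∂ν := by
  refine le_antisymm ?_ (iSup_lintegral_le _)
  set s := ⨆ i, ∫⁻ x, f i x ∂ν with hs
  rcases eq_or_ne s ∞ with hs' | hs'
  · rw [hs']; exact le_top
  have hle : ∀ i, ∫⁻ x, f i x ∂ν ≤ s := le_iSup fun i => ∫⁻ x, f i x ∂ν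
  -- An increasing sequence from the family already attains the supremum `s` of the integrals. Its
  -- pointwise supremum `l₀` has integral `s`, and it remains to see that `l₀` equals the full
  -- supremum almost everywhere.
  obtain ⟨u, -, hu, huS⟩ := exists_seq_tendsto_sSup (range_nonempty fun i => ∫⁻ x, f i x ∂ν)
    (OrderTop.bddAbove _)
  choose i hi using huS
  choose k hk₁ hk₂ using hd
  let j : ℕ → ι := fun n => Nat.rec (i 0) (fun n a => k a (i (n + 1))) n
  have hj : Monotone fun n => f (j n) := monotone_nat_of_le_succ fun n => hk₁ _ _
  have hij : ∀ n, f (i n) ≤ f (j n) := by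
    rintro (_ | n)
    · exact le_rfl
    · exact hk₂ _ _
  have hmeas : ∀ i, Measurable (f i) := fun i => (hf i).measurable
  set l₀ : X → ℝ≥0∞ := fun x => ⨆ n, f (j n) x with hl₀
  have hl₀m : Measurable l₀ := .iSup fun n => hmeas _
  have hlm : Measurable fun x => ⨆ i, f i x := (lowerSemicontinuous_iSup hf).measurable
  have hint : ∫⁻ x, l₀ x ∂ν = s := by
    rw [hl₀, lintegral_iSup (fun n => hmeas _) hj]
    refine le_antisymm (iSup_le fun n => hle _) (le_of_tendsto' hu fun n => ?_)
    rw [← hi n]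
    exact (lintegral_mono (hij n)).trans (le_iSup (fun n => ∫⁻ x, f (j n) x ∂ν) n)
  rw [← hint]
  refine lintegral_mono_ae ?_
  by_contra hne
  obtain ⟨q, hq⟩ : ∃ q : ℚ, ν ({x | l₀ x < Real.toNNReal q} ∩
      {x | (Real.toNNReal q : ℝ≥0∞) < ⨆ i, f i x}) ≠ 0 := by
    by_contra! h0
    refine hne ?_
    rw [ae_iff]
    refine measure_mono_null (fun x hx => ?_) (measure_iUnion_null h0)
    replace hx := not_le.mp hx
    obtain ⟨q, -, h1, h2⟩ := (ENNReal.lt_iff_exists_rat_btwn).mp hx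
    exact mem_iUnion.mpr ⟨q, h1, h2⟩
  obtain ⟨C, hCA, hC, hνC⟩ := hν _ ((measurableSet_lt hl₀m measurable_const).inter
    (measurableSet_lt measurable_const hlm)) hq
  -- Lower semicontinuity gives this near each point of `C`; compactness and directedness combine
  -- the finitely many indices into one.
  obtain ⟨a, ha⟩ : ∃ a, ∀ x ∈ C, (Real.toNNReal q : ℝ≥0∞) < f a x := by
    refine hC.induction_on (p := fun C => ∃ a, ∀ x ∈ C, (Real.toNNReal q : ℝ≥0∞) < f a x)
      ⟨Classical.arbitrary ι, by simp⟩ (fun s t hst ⟨a, ha⟩ => ⟨a, fun x hx => ha x (hst hx)⟩)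
      ?_ ?_
    · rintro s t ⟨a, ha⟩ ⟨b, hb⟩
      exact ⟨k a b, fun x hx => hx.elim (fun h => (ha x h).trans_le (hk₁ a b x))
        fun h => (hb x h).trans_le (hk₂ a b x)⟩
    · intro x hx
      obtain ⟨a, ha⟩ := lt_iSup_iff.mp (show (Real.toNNReal q : ℝ≥0∞) < ⨆ i, f i x from (hCA hx).2)
      exact ⟨_, mem_nhdsWithin_of_mem_nhds (hf a x _ ha), a, fun y hy => hy⟩
  -- The contradiction: this maximum strictly exceeds `l₀` on the non-null set `C`, although `∫ l₀
  -- dν = s` is finite.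
  have hmax : ∫⁻ x, max (f a x) (l₀ x) ∂ν ≤ s := by
    have h1 : ∀ x, max (f a x) (l₀ x) = ⨆ n, max (f a x) (f (j n) x) := fun x => sup_iSup
    simp_rw [h1]
    rw [lintegral_iSup (fun n => (hmeas a).max (hmeas _))
      fun n n' hn x => max_le_max le_rfl (hj hn x)]
    exact iSup_le fun n => (lintegral_mono fun x =>
      max_le (hk₁ a (j n) x) (hk₂ a (j n) x)).trans (hle (k a (j n)))
  refine (lt_of_lt_of_le ?_ hmax).ne hint
  refine lintegral_strict_mono_of_ae_le_of_ae_lt_on (s := C)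
    ((hmeas a).max hl₀m).aemeasurable (hint ▸ hs') (.of_forall fun x => le_max_right _ _) hνC
    (.of_forall fun x hx => ?_)
  exact ((hCA hx).1.trans (ha x hx)).trans_le (le_max_left _ _)

/-! ### The adjoint of a translation on bounded Borel functions -/

section Adjoint

variable {K : Type*} [TopologicalSpace K] [T2Space K] [LocallyCompactSpace K]
  [MeasurableSpace K] [BorelSpace K]

theorem continuous_ofReal_cc (f : C_c(K, ℝ)) : Continuous fun y => ENNReal.ofReal (f y) :=
  ENNReal.continuous_ofReal.comp (map_continuous f)

/-- The compactly supported functions `0 ≤ g ≤ 1` vanishing outside `U`. -/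
abbrev UnitBump (U : Set K) : Type _ :=
  {g : C_c(K, ℝ) // (∀ z, 0 ≤ g z) ∧ (∀ z, g z ≤ 1) ∧ ∀ z ∉ U, g z = 0}

instance (U : Set K) : Nonempty (UnitBump U) := ⟨⟨0, by simp⟩⟩

theorem UnitBump.directed (U : Set K) :
    Directed (· ≤ ·) fun (g : UnitBump U) (x : K) => ENNReal.ofReal (g.1 x) := by
  intro g g'
  refine ⟨⟨g.1 ⊔ g'.1, fun z => (g.2.1 z).trans le_sup_left,
    fun z => sup_le (g.2.2.1 z) (g'.2.2.1 z), fun z hz => ?_⟩,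
    fun z => ENNReal.ofReal_le_ofReal le_sup_left, fun z => ENNReal.ofReal_le_ofReal le_sup_right⟩
  change g.1 z ⊔ g'.1 z = 0
  rw [g.2.2.2 z hz, g'.2.2.2 z hz, sup_idem]

theorem UnitBump.iSup_eq_indicator {U : Set K} (hU : IsOpen U) (x : K) :
    ⨆ g : UnitBump U, ENNReal.ofReal (g.1 x) = U.indicator 1 x := by
  by_cases hx : x ∈ U
  · rw [indicator_of_mem hx]
    refine le_antisymm (iSup_le fun g => ENNReal.ofReal_le_one.mpr (g.2.2.1 x)) ?_
    obtain ⟨g, g1, g2, g3⟩ := exists_cutoff isCompact_singleton hU (singleton_subset_iff.mpr hx)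
    refine le_iSup_of_le ⟨g, fun z => (g3 z).1, fun z => (g3 z).2, g2⟩ ?_
    simp [g1 x rfl]
  · rw [indicator_of_notMem hx]
    simp +contextual [hx]

theorem UnitBump.iSup_lintegral_eq {U : Set K} (hU : IsOpen U) (ν : Measure K) [IsFiniteMeasure ν]
    (hν : ∀ A, MeasurableSet A → ν A ≠ 0 → ∃ C ⊆ A, IsCompact C ∧ ν C ≠ 0) :
    ⨆ g : UnitBump U, ∫⁻ x, ENNReal.ofReal (g.1 x) ∂ν = ν U := by
  rw [← lintegral_iSup_of_directed_lowerSemicontinuous ν hν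
    (fun (g : UnitBump U) x => ENNReal.ofReal (g.1 x))
    (fun g => (continuous_ofReal_cc g.1).lowerSemicontinuous)
    (UnitBump.directed U)]
  simp_rw [UnitBump.iSup_eq_indicator hU]
  exact lintegral_indicator_one hU.measurableSet

theorem exists_isCompact_ne_zero_of_regular (ν : Measure K) [IsFiniteMeasure ν] [ν.Regular]
    {A : Set K} (hA : MeasurableSet A) (h : ν A ≠ 0) : ∃ C ⊆ A, IsCompact C ∧ ν C ≠ 0 := by
  obtain ⟨C, hCA, hC, h⟩ := hA.exists_lt_isCompact_of_ne_top (measure_ne_top ν A)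
    (pos_iff_ne_zero.mpr h)
  exact ⟨C, hCA, hC, h.ne'⟩

/-- The set `A ∩ {h ≠ 0}` has positive `m`-measure, and any compact subset of it with positive
`m`-measure is also charged by `h · m`. -/
theorem exists_isCompact_withDensity_ne_zero (m : Measure K) [m.InnerRegular] {h : K → ℝ≥0∞}
    (hh : Measurable h) {A : Set K} (hA : MeasurableSet A) (hne : m.withDensity h A ≠ 0) :
    ∃ C ⊆ A, IsCompact C ∧ m.withDensity h C ≠ 0 := by
  have h1 : m ({x | h x ≠ 0} ∩ A) ≠ 0 := fun h0 =>
    hne ((withDensity_apply_eq_zero hh).mpr h0)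
  have hm : MeasurableSet ({x | h x ≠ 0} ∩ A) :=
    (hh (measurableSet_singleton 0).compl).inter hA
  obtain ⟨C, hCA, hC, h2⟩ := hm.exists_lt_isCompact (pos_iff_ne_zero.mpr h1)
  refine ⟨C, fun x hx => (hCA hx).2, hC, fun h0 => ?_⟩
  rw [withDensity_apply_eq_zero hh, inter_eq_right.mpr fun x hx => (hCA hx).1] at h0
  exact h2.ne' h0

theorem lintegral_withDensity_cc (m : Measure K) [IsFiniteMeasureOnCompacts m] {f h : C_c(K, ℝ)}
    (hf : ∀ t, 0 ≤ f t) (hh : ∀ t, 0 ≤ h t) :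
    ∫⁻ y, ENNReal.ofReal (f y) ∂(m.withDensity fun y => ENNReal.ofReal (h y)) =
      ENNReal.ofReal (∫ y, f y * h y ∂m) := by
  rw [lintegral_withDensity_eq_lintegral_mul _
    (continuous_ofReal_cc h).measurable
    (continuous_ofReal_cc f).measurable,
    ofReal_integral_eq_lintegral_ofReal (f := fun y => f y * h y)
      (integrable_cc m (f * h))
      (.of_forall fun y => mul_nonneg (hf y) (hh y))]
  refine lintegral_congr fun y => ?_
  rw [Pi.mul_apply, ← ENNReal.ofReal_mul (hh y), mul_comm]

theorem isFiniteMeasure_withDensity_cc (m : Measure K) [IsFiniteMeasureOnCompacts m]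
    (h : C_c(K, ℝ)) : IsFiniteMeasure (m.withDensity fun y => ENNReal.ofReal (h y)) :=
  isFiniteMeasure_withDensity_ofReal (integrable_cc m h).2

variable [CommHypergroup K]

/-- The measures `∫ ω(x, y) h(y) dm(y)` and `T_x̃ h · m` agree. -/
theorem IsHaarMeasure.bind_conv_withDensity {m : Measure K} (hm : IsHaarMeasure m) (x : K)
    {h : C_c(K, ℝ)} (hh : ∀ t, 0 ≤ h t) :
    (m.withDensity fun y => ENNReal.ofReal (h y)).bind (conv x) =
      m.withDensity fun y => ENNReal.ofReal (ccTranslate (inv x) h y) := by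
  have := hm.isFiniteMeasureOnCompacts
  have := hm.innerRegular
  have := isFiniteMeasure_withDensity_cc m h
  have := isFiniteMeasure_withDensity_cc m (ccTranslate (inv x) h)
  set ν := m.withDensity fun y => ENNReal.ofReal (h y)
  have hmeas : ∀ h : C_c(K, ℝ), Measurable fun y => ENNReal.ofReal (h y) := fun h =>
    (continuous_ofReal_cc h).measurable
  have hbind : ∀ s, MeasurableSet s → ν.bind (conv x) s = ∫⁻ y, conv x y s ∂ν := fun s hs =>
    Measure.bind_apply hs (measurable_conv x).aemeasurable
  have hfin : IsFiniteMeasure (ν.bind (conv x)) := ⟨by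
    rw [hbind _ .univ]
    simp⟩
  have hopen : ∀ U, IsOpen U → ν.bind (conv x) U =
      m.withDensity (fun y => ENNReal.ofReal (ccTranslate (inv x) h y)) U := by
    intro U hU
    rw [hbind _ hU.measurableSet, ← UnitBump.iSup_lintegral_eq hU _ fun A hA hne =>
      exists_isCompact_withDensity_ne_zero m (hmeas (ccTranslate (inv x) h)) hA hne]
    have hc : ∀ y, conv x y U =
        ⨆ g : UnitBump U, ENNReal.ofReal (ccTranslate x g.1 y) := by
      intro y
      rw [← UnitBump.iSup_lintegral_eq hU _ fun A hA hne =>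
        exists_isCompact_ne_zero_of_regular (conv x y) hA hne]
      exact iSup_congr fun g => (ofReal_integral_eq_lintegral_ofReal
        (integrable_conv x y (map_continuous g.1)) (.of_forall g.2.1)).symm
    simp_rw [hc]
    -- An open set need not be a countable supremum of `C_c` functions, hence the version for nets.
    -- For each bump `g` the claim becomes the adjoint relation `∫ T_x g · h dm = ∫ g · T_x̃ h dm`.
    rw [lintegral_iSup_of_directed_lowerSemicontinuous ν fun A hA hne =>
      exists_isCompact_withDensity_ne_zero m (hmeas h) hA hne]
    · refine iSup_congr fun g => ?_
      rw [lintegral_withDensity_cc m (ccTranslate_nonneg g.2.1 x) hh,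
        lintegral_withDensity_cc m g.2.1 (ccTranslate_nonneg hh _), hm.integral_ccTranslate_mul]
    · exact fun g => (continuous_ofReal_cc (ccTranslate x g.1)).lowerSemicontinuous
    · intro g g'
      obtain ⟨k, hk, hk'⟩ := UnitBump.directed U g g'
      have hmono : ∀ a b : UnitBump U,
          ((fun x => ENNReal.ofReal (a.1 x)) ≤ fun x => ENNReal.ofReal (b.1 x)) →
          (fun y => ENNReal.ofReal (ccTranslate x a.1 y)) ≤
            fun y => ENNReal.ofReal (ccTranslate x b.1 y) := fun a b hab y =>
        ENNReal.ofReal_le_ofReal (integral_mono (integrable_conv x y (map_continuous a.1))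
          (integrable_conv x y (map_continuous b.1)) fun t =>
            (ENNReal.ofReal_le_ofReal_iff (b.2.1 t)).mp (hab t))
      exact ⟨k, hmono _ _ hk, hmono _ _ hk'⟩
  refine ext_of_generate_finite {U : Set K | IsOpen U} (BorelSpace.measurable_eq (α := K))
    isPiSystem_isOpen hopen (hopen univ isOpen_univ)

/-- The adjoint of `T_x` is `T_x̃`, for a bounded Borel function and a compactly supported one. -/
theorem IsHaarMeasure.integral_translate_mul {m : Measure K} (hm : IsHaarMeasure m) (x : K)
    {φ : K → ℂ} (hφ : Measurable φ) (hb : ∃ C : ℝ, ∀ t, ‖φ t‖ ≤ C) {h : C_c(K, ℝ)}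
    (hh : ∀ t, 0 ≤ h t) :
    ∫ y, h y • translate x φ y ∂m = ∫ y, ccTranslate (inv x) h y • φ y ∂m := by
  have := hm.isFiniteMeasureOnCompacts
  obtain ⟨C, hC⟩ := hb
  have hd : ∀ (g : C_c(K, ℝ)) (ψ : K → ℂ), (∀ t, 0 ≤ g t) →
      ∫ y, ψ y ∂(m.withDensity fun y => ENNReal.ofReal (g y)) = ∫ y, g y • ψ y ∂m := by
    intro g ψ hg
    rw [integral_withDensity_eq_integral_toReal_smul
      (continuous_ofReal_cc g).measurable
      (.of_forall fun _ => ENNReal.ofReal_lt_top)]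
    simp_rw [ENNReal.toReal_ofReal (hg _)]
  rw [← hd _ _ hh, ← hd _ _ (ccTranslate_nonneg hh _), ← hm.bind_conv_withDensity x hh]
  have := isFiniteMeasure_withDensity_cc m h
  let κ : ProbabilityTheory.Kernel K K := ⟨conv x, measurable_conv x⟩
  have : ProbabilityTheory.IsMarkovKernel κ := ⟨fun y => isProbabilityMeasure_conv x y⟩
  set ν := m.withDensity fun y => ENNReal.ofReal (h y)
  have key := ProbabilityTheory.Kernel.integral_comp (η := κ)
    (κ := ProbabilityTheory.Kernel.const Unit ν) (a := ()) (f := φ)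
    (Integrable.of_bound hφ.aestronglyMeasurable C (.of_forall hC))
  rw [ProbabilityTheory.Kernel.comp_apply, ProbabilityTheory.Kernel.const_apply] at key
  exact key.symm

end Adjoint

/-! ### Restricting functionals on `L^∞` to bounded continuous functions -/

section Functionals

variable {K : Type*} [TopologicalSpace K] [T2Space K] [LocallyCompactSpace K]
  [MeasurableSpace K] [BorelSpace K]

theorem ae_norm_le_norm_Lp {m : Measure K} (φ : Lp ℂ ∞ m) : ∀ᵐ y ∂m, ‖φ y‖ ≤ ‖φ‖ := by
  filter_upwards [ae_le_eLpNormEssSup (f := φ) (μ := m)] with y hy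
  rw [← eLpNorm_exponent_top] at hy
  have := ENNReal.toReal_mono (Lp.eLpNorm_ne_top φ) hy
  rwa [toReal_enorm] at this

theorem integrable_cc_smul {m : Measure K} [IsFiniteMeasureOnCompacts m] (h : C_c(K, ℝ))
    {φ : K → ℂ} (hφ : MemLp φ ∞ m) : Integrable (fun y => h y • φ y) m :=
  (integrable_cc m h).smul_of_top_left hφ

theorem norm_integral_cc_smul_le {m : Measure K} [IsFiniteMeasureOnCompacts m] (h : C_c(K, ℝ))
    (φ : Lp ℂ ∞ m) : ‖∫ y, h y • φ y ∂m‖ ≤ ‖φ‖ * ∫ y, |h y| ∂m := by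
  rw [← integral_const_mul]
  refine norm_integral_le_of_norm_le ((integrable_cc m h).abs.const_mul _) ?_
  filter_upwards [ae_norm_le_norm_Lp φ] with y hy
  rw [norm_smul, Real.norm_eq_abs, mul_comm]
  exact mul_le_mul_of_nonneg_right hy (abs_nonneg _)

section

variable [Hypergroup K]

/-- The embedding of the bounded continuous functions into `L^∞`. -/
def bcfToLinfty (m : Measure K) : (K →ᵇ ℂ) →L[ℂ] Lp ℂ ∞ m :=
  LinearMap.mkContinuous
    { toFun := fun f => toLinfty m f f.continuous.measurable ⟨_, f.norm_coe_le_norm⟩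
      map_add' := fun _ _ => rfl
      map_smul' := fun _ _ => rfl } 1 fun f => by
    rw [one_mul]
    change ‖toLinfty m f f.continuous.measurable ⟨_, f.norm_coe_le_norm⟩‖ ≤ ‖f‖
    rw [toLinfty, Lp.norm_toLp]
    refine ENNReal.toReal_le_of_le_ofReal (norm_nonneg f) ?_
    rw [eLpNorm_exponent_top]
    exact eLpNormEssSup_le_of_ae_bound (.of_forall f.norm_coe_le_norm)

theorem continuous_translate (x : K) {f : K → ℂ} (hf : Continuous f) :
    Continuous (translate x f) :=
  continuous_integral_conv_complex continuous_const continuous_id (G := fun _ s => f s)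
    (hf.comp continuous_snd)

/-- The translation `T_x` on bounded continuous functions. -/
def translateBCF (x : K) : (K →ᵇ ℂ) →L[ℂ] (K →ᵇ ℂ) :=
  LinearMap.mkContinuous
    { toFun := fun f => BoundedContinuousFunction.ofNormedAddCommGroup (translate x f)
        (continuous_translate x f.continuous) ‖f‖ (norm_translate_le x f.norm_coe_le_norm)
      map_add' := fun f g => by
        ext y
        exact integral_add (integrable_conv x y f.continuous) (integrable_conv x y g.continuous)
      map_smul' := fun c f => by
        ext y
        exact integral_const_mul c _ } 1 fun f => by
    rw [one_mul]
    exact BoundedContinuousFunction.norm_ofNormedAddCommGroup_le _ (norm_nonneg f)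
      (norm_translate_le x f.norm_coe_le_norm)

/-- A character as a bounded continuous function. -/
def Dual.toBCF (α : Dual K) : K →ᵇ ℂ :=
  BoundedContinuousFunction.ofNormedAddCommGroup α.1 α.1.continuous _ α.2.2.1.choose_spec

theorem Dual.apply_e (α : Dual K) : α.1 e = 1 := by
  obtain ⟨x, hx⟩ := DFunLike.ne_iff.mp α.2.1
  have h := α.2.2.2.1 x e
  rw [integral_conv_e x _ α.1.continuous.stronglyMeasurable] at h
  exact mul_left_cancel₀ hx (h.symm.trans (mul_one _).symm)

/-- An `α`-amenable hypergroup carries an `α`-invariant functional on its bounded continuous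
functions. -/
theorem IsAmenableAt.exists_functional {m : Measure K} {α : Dual K} (h : IsAmenableAt m α) :
    ∃ N : StrongDual ℂ (K →ᵇ ℂ), N α.toBCF = 1 ∧
      ∀ x f, N (translateBCF x f) = α.1 x * N f := by
  obtain ⟨M, h1, h2⟩ := h
  exact ⟨M.comp (bcfToLinfty m), h1, fun x f => h2 x f f.continuous.measurable ⟨_, f.norm_coe_le_norm⟩⟩

end

end Functionals

/-! ### Smoothing, and the return from continuous functions to `L^∞` -/

section Smoothing

variable {K : Type*} [TopologicalSpace K] [T2Space K] [LocallyCompactSpace K]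
  [MeasurableSpace K] [BorelSpace K] [CommHypergroup K]

/-- The convolution `x ↦ ∫ φ(y) T_x̃ F(y) dm(y)`. -/
def smooth (m : Measure K) (F : C_c(K, ℝ)) (φ : K → ℂ) (x : K) : ℂ :=
  ∫ y, ccTranslate (inv x) F y • φ y ∂m

theorem smooth_congr_ae {m : Measure K} (F : C_c(K, ℝ)) {φ ψ : K → ℂ} (h : φ =ᵐ[m] ψ) :
    smooth m F φ = smooth m F ψ := by
  ext x
  refine integral_congr_ae ?_
  filter_upwards [h] with y hy
  rw [hy]

theorem smooth_add_const_mul {m : Measure K} [IsFiniteMeasureOnCompacts m] (F : C_c(K, ℝ))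
    {φ ψ : K → ℂ} (hφ : MemLp φ ∞ m) (hψ : MemLp ψ ∞ m) (c : ℂ) (x : K) :
    smooth m F (fun y => φ y + c * ψ y) x = smooth m F φ x + c * smooth m F ψ x := by
  rw [smooth, smooth, smooth, ← integral_const_mul, ← integral_add (integrable_cc_smul _ hφ)
    ((integrable_cc_smul _ hψ).const_mul c)]
  simp only [smul_add, mul_smul_comm]

/-- For `x` in a compact neighbourhood of a point, the kernels `T_x̃ F` vanish off a common compact
set, on which the bounded `φ` is integrable. -/
theorem continuous_smooth {m : Measure K} [IsFiniteMeasureOnCompacts m] (F : C_c(K, ℝ))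
    {φ : K → ℂ} (hφ : MemLp φ ∞ m) : Continuous (smooth m F φ) := by
  rw [continuous_iff_continuousAt]
  intro x₀
  obtain ⟨C, hC, hxC⟩ := exists_compact_mem_nhds x₀
  obtain ⟨D, hD, h0⟩ := exists_isCompact_ccTranslate_eq_zero (hC.image continuous_inv) F
  have hloc : IntegrableOn φ D m := by
    have : IsFiniteMeasure (m.restrict D) := ⟨by simpa using hD.measure_lt_top⟩
    exact (hφ.mono_measure Measure.restrict_le_self).integrable le_top
  exact (continuousOn_integral_bilinear_of_locally_integrable_of_compact_support
    (ContinuousLinearMap.lsmul ℝ ℝ).flip (f := fun x y => ccTranslate (inv x) F y) hD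
    ((continuous_ccTranslate F).comp
      ((continuous_inv.comp continuous_fst).prodMk continuous_snd)).continuousOn
    (fun x y hx hy => h0 _ ⟨x, hx, rfl⟩ y hy) hloc).continuousAt hxC

variable {m : Measure K}

/-- Pointwise `|T_x h| ≤ T_x |h|`, and Haar measure is invariant. -/
theorem IsHaarMeasure.integral_abs_ccTranslate_le (hm : IsHaarMeasure m) (x : K)
    (h : C_c(K, ℝ)) : ∫ y, |ccTranslate x h y| ∂m ≤ ∫ y, |h y| ∂m := by
  have := hm.isFiniteMeasureOnCompacts
  let h' : C_c(K, ℝ) := ⟨⟨fun y => |h y|, (map_continuous h).abs⟩, h.hasCompactSupport.abs⟩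
  rw [show ∫ y, |h y| ∂m = ∫ y, h' y ∂m from rfl, ← hm.integral_ccTranslate x h']
  exact integral_mono (integrable_cc m _).abs (integrable_cc m _) fun y => abs_integral_le_integral_abs

/-- Smoothing as a bounded operator from `L^∞` to the bounded continuous functions. -/
def smoothCLM (hm : IsHaarMeasure m) (F : C_c(K, ℝ)) : Lp ℂ ∞ m →L[ℂ] (K →ᵇ ℂ) :=
  have := hm.isFiniteMeasureOnCompacts
  have hbound : ∀ (φ : Lp ℂ ∞ m) (x : K), ‖smooth m F φ x‖ ≤ (∫ y, |F y| ∂m) * ‖φ‖ := fun φ x => by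
    rw [mul_comm]
    exact (norm_integral_cc_smul_le _ φ).trans (mul_le_mul_of_nonneg_left
      (hm.integral_abs_ccTranslate_le _ F) (norm_nonneg _))
  LinearMap.mkContinuous
    { toFun := fun φ => BoundedContinuousFunction.ofNormedAddCommGroup (smooth m F φ)
        (continuous_smooth F (Lp.memLp φ)) _ (hbound φ)
      map_add' := fun φ ψ => by
        ext x
        have h := smooth_add_const_mul F (Lp.memLp φ) (Lp.memLp ψ) 1 x
        simp only [one_mul] at h
        exact (congrFun (smooth_congr_ae F (Lp.coeFn_add φ ψ)) x).trans h
      map_smul' := fun c φ => by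
        ext x
        refine (congrFun (smooth_congr_ae F (Lp.coeFn_smul c φ)) x).trans ?_
        change ∫ y, _ ∂m = c * ∫ y, _ ∂m
        rw [← integral_const_mul]
        simp only [Pi.smul_apply, smul_eq_mul, mul_smul_comm] } (∫ y, |F y| ∂m) fun φ =>
    BoundedContinuousFunction.norm_ofNormedAddCommGroup_le _
      (mul_nonneg (integral_nonneg fun _ => abs_nonneg _) (norm_nonneg _)) (hbound φ)

theorem smoothCLM_toLinfty (hm : IsHaarMeasure m) (F : C_c(K, ℝ)) {φ : K → ℂ} (hφ : Measurable φ)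
    (hb : ∃ C : ℝ, ∀ t, ‖φ t‖ ≤ C) (x : K) :
    smoothCLM hm F (toLinfty m φ hφ hb) x = smooth m F φ x :=
  congrFun (smooth_congr_ae F (MemLp.coeFn_toLp _)) x

/-- By adjointness the translation moves from `F` to the character, where `T_x γ = γ(x) γ`. -/
theorem IsHaarMeasure.smooth_char (hm : IsHaarMeasure m) {F : C_c(K, ℝ)} (hF : ∀ t, 0 ≤ F t)
    (γ : Dual K) (x : K) : smooth m F γ.1 x = γ.1 x * ∫ y, F y • γ.1 y ∂m := by
  rw [smooth, ← hm.integral_translate_mul x γ.1.continuous.measurable γ.2.2.1 hF,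
    ← integral_const_mul]
  refine integral_congr_ae (.of_forall fun y => ?_)
  change F y • translate x γ.1 y = _
  rw [translate, γ.2.2.2.1]
  exact (mul_smul_comm _ _ _).symm

/-- A bounded nonnegative `φ` can be absorbed into the measure `φ · m`, leaving a continuous kernel
to which Fubini for compact supports applies. -/
theorem translate_smooth_of_nonneg [IsFiniteMeasureOnCompacts m] (F : C_c(K, ℝ)) (z x : K)
    {φ : K → ℝ} (hφ : Measurable φ) (h0 : ∀ t, 0 ≤ φ t) {C : ℝ} (hC : ∀ t, φ t ≤ C) :
    translate z (smooth m F fun y => (φ y : ℂ)) x =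
      ∫ y, (∫ u, ccTranslate (inv u) F y ∂(conv z x)) • (φ y : ℂ) ∂m := by
  set ν := m.withDensity fun y => ENNReal.ofReal (φ y)
  have hν : IsFiniteMeasureOnCompacts ν := ⟨fun S hS => by
    rw [withDensity_apply _ hS.measurableSet]
    calc ∫⁻ y in S, ENNReal.ofReal (φ y) ∂m ≤ ∫⁻ y in S, ENNReal.ofReal C ∂m :=
          lintegral_mono fun y => ENNReal.ofReal_le_ofReal (hC y)
      _ < ∞ := by
          rw [setLIntegral_const]
          exact ENNReal.mul_lt_top ENNReal.ofReal_lt_top hS.measure_lt_top⟩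
  have hd : ∀ g : K → ℝ, ∫ y, g y ∂ν = ∫ y, g y * φ y ∂m := by
    intro g
    rw [integral_withDensity_eq_integral_toReal_smul hφ.ennreal_ofReal
      (.of_forall fun _ => ENNReal.ofReal_lt_top)]
    simp_rw [ENNReal.toReal_ofReal (h0 _), smul_eq_mul, mul_comm]
  obtain ⟨D, hD, hD0⟩ := exists_isCompact_ccTranslate_eq_zero
    ((isCompact_support_conv z x).image continuous_inv) F
  have key := integral_swap_of_compact (conv z x) ν (isCompact_support_conv z x)
    (f := fun u y => ccTranslate (inv u) F y) ((continuous_ccTranslate F).comp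
      ((continuous_inv.comp continuous_fst).prodMk continuous_snd)) hD
    (fun u hu y hy => hD0 _ ⟨u, hu, rfl⟩ y hy)
  simp_rw [hd] at key
  have hs : ∀ u, smooth m F (fun y => (φ y : ℂ)) u =
      ((∫ y, ccTranslate (inv u) F y * φ y ∂m : ℝ) : ℂ) := by
    intro u
    rw [smooth, ← integral_complex_ofReal]
    simp
  rw [translate]
  simp_rw [hs]
  rw [integral_complex_ofReal, key, ← integral_complex_ofReal]
  simp

/-- Smoothing commutes with translations. -/
theorem IsHaarMeasure.smooth_translate (hm : IsHaarMeasure m) {F : C_c(K, ℝ)}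
    (hF : ∀ t, 0 ≤ F t) (z x : K) {φ : K → ℂ} (hφ : Measurable φ)
    (hb : ∃ C : ℝ, ∀ t, ‖φ t‖ ≤ C) :
    smooth m F (translate z φ) x = translate z (smooth m F φ) x := by
  have := hm.isFiniteMeasureOnCompacts
  rw [smooth, hm.integral_translate_mul z hφ hb (ccTranslate_nonneg hF _)]
  have hcc : ∀ y, ccTranslate (inv z) (ccTranslate (inv x) F) y =
      ∫ u, ccTranslate (inv u) F y ∂(conv z x) := by
    intro y
    rw [ccTranslate_ccTranslate, CommHypergroup.conv_comm z x, integral_comp_inv x z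
      (f := fun t => ccTranslate t F y)
      ((continuous_ccTranslate F).comp (Continuous.prodMk_left y))]
  symm
  obtain ⟨C, hC⟩ := hb
  -- linearity reduces the claim to nonnegative functions
  have hlin : ∀ {φ ψ : K → ℂ} (c : ℂ), MemLp φ ∞ m → MemLp ψ ∞ m →
      translate z (smooth m F φ) x =
        ∫ y, ccTranslate (inv z) (ccTranslate (inv x) F) y • φ y ∂m →
      translate z (smooth m F ψ) x =
        ∫ y, ccTranslate (inv z) (ccTranslate (inv x) F) y • ψ y ∂m →
      translate z (smooth m F fun y => φ y + c * ψ y) x =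
        ∫ y, ccTranslate (inv z) (ccTranslate (inv x) F) y • (φ y + c * ψ y) ∂m := by
    intro φ ψ c hφ hψ h1 h2
    simp_rw [smul_add, ← mul_smul_comm]
    rw [integral_add (integrable_cc_smul _ hφ) ((integrable_cc_smul _ hψ).const_mul c),
      integral_const_mul, ← h1, ← h2, translate, translate, translate, ← integral_const_mul,
      ← integral_add (integrable_conv z x (continuous_smooth F hφ))
        ((integrable_conv z x (continuous_smooth F hψ)).const_mul c)]
    exact integral_congr_ae (.of_forall fun u => smooth_add_const_mul F hφ hψ c u)
  have hpos : ∀ {φ : K → ℝ}, Measurable φ → (∀ t, |φ t| ≤ C) →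
      MemLp (fun y => (φ y : ℂ)) ∞ m ∧ translate z (smooth m F fun y => (φ y : ℂ)) x =
        ∫ y, ccTranslate (inv z) (ccTranslate (inv x) F) y • (φ y : ℂ) ∂m := by
    intro φ hφ hφC
    have hmem : ∀ {ψ : K → ℝ} {A : ℝ}, Measurable ψ → (∀ t, |ψ t| ≤ A) →
        MemLp (fun y => (ψ y : ℂ)) ∞ m := fun hψ hA =>
      memLp_top_of_bounded m (Complex.measurable_ofReal.comp hψ) fun t =>
        (Complex.norm_real _).trans_le (hA t)
    refine ⟨hmem hφ hφC, ?_⟩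
    have hC0 : 0 ≤ C := (abs_nonneg _).trans (hφC x)
    have e1 := translate_smooth_of_nonneg (m := m) F z x (hφ.add_const C)
      (fun t => by linarith [(abs_le.mp (hφC t)).1]) (C := 2 * C)
      -- Here a real `φ` with `|φ| ≤ C` is written as `(φ + C) - C`, a difference of nonnegative
      -- functions; `φ + C` is bounded by `2 * C`.
      (fun t => by linarith [(abs_le.mp (hφC t)).2])
    have e2 := translate_smooth_of_nonneg (m := m) F z x (φ := fun _ => C) measurable_const
      (fun _ => hC0) (fun _ => le_rfl)
    simp_rw [← hcc] at e1 e2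
    have := hlin (-1) (hmem (A := 2 * C) (hφ.add_const C) fun t => abs_le.mpr
      ⟨by linarith [(abs_le.mp (hφC t)).1], by linarith [(abs_le.mp (hφC t)).2]⟩)
      (hmem (A := C) (ψ := fun _ => C) measurable_const fun _ => (abs_of_nonneg hC0).le) e1 e2
    simpa using this
  obtain ⟨m1, h1⟩ := hpos (Complex.measurable_re.comp hφ)
    fun t => (Complex.abs_re_le_norm _).trans (hC t)
  obtain ⟨m2, h2⟩ := hpos (Complex.measurable_im.comp hφ)
    fun t => (Complex.abs_im_le_norm _).trans (hC t)
  have h := hlin Complex.I m1 m2 h1 h2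
  have hφ' : ∀ y, (((Complex.re ∘ φ) y : ℝ) : ℂ) + Complex.I * (((Complex.im ∘ φ) y : ℝ) : ℂ) =
      φ y := fun y => by
    rw [mul_comm]; exact Complex.re_add_im (φ y)
  simpa only [hφ'] using h

/-- Since `γ(e) = 1`, a bump supported where `Re γ > 1/2` gives `∫ F Re γ dm ≥ (1/2) ∫ F dm > 0`. -/
theorem IsHaarMeasure.exists_integral_smul_char_ne_zero (hm : IsHaarMeasure m) (γ : Dual K) :
    ∃ F : C_c(K, ℝ), (∀ t, 0 ≤ F t) ∧ ∫ y, F y • γ.1 y ∂m ≠ 0 := by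
  have := hm.isFiniteMeasureOnCompacts
  have hopen : IsOpen {y : K | 1 / 2 < (γ.1 y).re} :=
    isOpen_lt continuous_const (Complex.continuous_re.comp γ.1.continuous)
  obtain ⟨F, hF0, hFU, hFe, -⟩ := exists_symmetric_bump hopen (by
    change 1 / 2 < (γ.1 e).re
    rw [γ.apply_e]; norm_num)
  refine ⟨F, hF0, fun h => ?_⟩
  have hmem := memLp_top_of_bounded m γ.1.continuous.measurable γ.2.2.1.choose_spec
  have hint := integrable_cc_smul F hmem
  have hre : ∫ y, F y * (γ.1 y).re ∂m = 0 := by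
    have := integral_re hint
    simp only [h] at this
    simpa using this
  have hle : ∫ y, F y * (1 / 2) ∂m ≤ ∫ y, F y * (γ.1 y).re ∂m := by
    refine integral_mono ((integrable_cc m F).mul_const _) (by simpa using hint.re) fun y => ?_
    by_cases hy : y ∈ {y : K | 1 / 2 < (γ.1 y).re}
    · exact mul_le_mul_of_nonneg_left (le_of_lt hy) (hF0 y)
    · simp [hFU y hy]
  rw [hre, integral_mul_const] at hle
  linarith [hm.integral_pos hF0 hFe]

/-- To prove `γ`-amenability it suffices to have a `γ`-invariant functional on a space of bounded
continuous functions that contains all smoothings. -/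
theorem IsHaarMeasure.isAmenableAt_of_functional (hm : IsHaarMeasure m) (γ : Dual K)
    (V : Submodule ℂ (K →ᵇ ℂ)) (hV : ∀ F φ, smoothCLM hm F φ ∈ V) (hγ : γ.toBCF ∈ V)
    (N : V →L[ℂ] ℂ) (hN : N ⟨_, hγ⟩ = 1)
    (hinv : ∀ (x : K) (f g : V), (g : K →ᵇ ℂ) = translateBCF x f → N g = γ.1 x * N f) :
    IsAmenableAt m γ := by
  obtain ⟨F, hF0, hF⟩ := hm.exists_integral_smul_char_ne_zero γ
  set c := ∫ y, F y • γ.1 y ∂m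
  -- Smoothing sends `γ` to `c γ`, hence the factor `c⁻¹`.
  refine ⟨c⁻¹ • N.comp ((smoothCLM hm F).codRestrict V (hV F)), ?_, fun x φ hφ hb => ?_⟩
  · have h : (smoothCLM hm F).codRestrict V (hV F)
        (toLinfty m γ.1 γ.1.continuous.measurable γ.2.2.1) = c • ⟨_, hγ⟩ := by
      ext x
      change smoothCLM hm F _ x = c * γ.1 x
      rw [smoothCLM_toLinfty, hm.smooth_char hF0, mul_comm]
    rw [smul_apply, ContinuousLinearMap.comp_apply, h, map_smul, hN,
      smul_eq_mul, smul_eq_mul, mul_one, inv_mul_cancel₀ hF]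
  · rw [smul_apply, smul_apply,
      ContinuousLinearMap.comp_apply, ContinuousLinearMap.comp_apply, smul_eq_mul, smul_eq_mul,
      mul_left_comm]
    congr 1
    -- The translate of a smoothing is the smoothing of a translate, so it lies in `V`; `V` itself
    -- need not be translation invariant.
    refine hinv x _ _ ?_
    ext y
    change smoothCLM hm F _ y = translate x (smoothCLM hm F _) y
    rw [smoothCLM_toLinfty, hm.smooth_translate hF0 x y hφ hb]
    refine integral_congr_ae (.of_forall fun u => ?_)
    exact (smoothCLM_toLinfty hm F hφ hb u).symm

theorem IsHaarMeasure.isAmenableAt_of_functional_bcf (hm : IsHaarMeasure m) (γ : Dual K)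
    (N : StrongDual ℂ (K →ᵇ ℂ)) (hN : N γ.toBCF = 1)
    (hinv : ∀ x f, N (translateBCF x f) = γ.1 x * N f) : IsAmenableAt m γ := by
  refine hm.isAmenableAt_of_functional γ ⊤ (fun _ _ => trivial) trivial
    (N.comp (Submodule.subtypeL ⊤)) hN fun x f g hfg => ?_
  change N g = γ.1 x * N f
  rw [hfg, hinv]

theorem ccTranslate_sub (x : K) (f g : C_c(K, ℝ)) :
    ccTranslate x (f - g) = ccTranslate x f - ccTranslate x g := by
  ext y
  exact integral_sub (integrable_conv x y (map_continuous f))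
    (integrable_conv x y (map_continuous g))

theorem ccTranslate_of_conv_eq_dirac {p q r : K} (h : conv p q = Measure.dirac r)
    (F : C_c(K, ℝ)) : ccTranslate r F = ccTranslate q (ccTranslate p F) := by
  ext z
  rw [ccTranslate_ccTranslate, CommHypergroup.conv_comm, h,
    integral_dirac' (fun t => ccTranslate t F z) _
      ((continuous_ccTranslate F).comp (Continuous.prodMk_left z)).stronglyMeasurable]

/-- With `G = T_{x₀} F` this is continuity of translation in `L¹`; near a point all the integrands
vanish off one compact set. -/
theorem continuous_integral_abs_ccTranslate_sub [IsFiniteMeasureOnCompacts m] (F G : C_c(K, ℝ)) :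
    Continuous fun x => ∫ y, |(ccTranslate x F - G) y| ∂m := by
  rw [continuous_iff_continuousAt]
  intro x₀
  obtain ⟨C, hC, hxC⟩ := exists_compact_mem_nhds x₀
  obtain ⟨D, hD, h0⟩ := exists_isCompact_ccTranslate_eq_zero hC F
  refine (continuousOn_integral_of_compact_support (s := C)
    (f := fun x y => |(ccTranslate x F - G) y|) (hD.union G.hasCompactSupport.isCompact)
    ?_ ?_).continuousAt hxC
  · exact ((continuous_ccTranslate F).sub ((map_continuous G).comp
      continuous_snd)).abs.continuousOn
  · intro x y hx hy
    rw [CompactlySupportedContinuousMap.sub_apply, h0 x hx y fun h => hy (.inl h),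
      image_eq_zero_of_notMem_tsupport fun h => hy (.inr h)]
    simp

/-- If `δ_p * δ_q` and `δ_p₀ * δ_q` are the point masses at `r̃` and `r̃₀`, then the difference of a
smoothing at `r` and `r₀` is bounded independently of `q`. -/
theorem IsHaarMeasure.norm_smooth_sub_le (hm : IsHaarMeasure m) (F : C_c(K, ℝ)) (φ : Lp ℂ ∞ m)
    {p p₀ q r r₀ : K} (h : conv p q = Measure.dirac (inv r))
    (h₀ : conv p₀ q = Measure.dirac (inv r₀)) :
    ‖smooth m F φ r - smooth m F φ r₀‖ ≤
      ‖φ‖ * ∫ y, |(ccTranslate p F - ccTranslate p₀ F) y| ∂m := by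
  have := hm.isFiniteMeasureOnCompacts
  rw [smooth, smooth, ← integral_sub (integrable_cc_smul _ (Lp.memLp φ))
    (integrable_cc_smul _ (Lp.memLp φ)), ccTranslate_of_conv_eq_dirac h,
    ccTranslate_of_conv_eq_dirac h₀]
  simp_rw [← sub_smul, ← CompactlySupportedContinuousMap.sub_apply]
  -- The common factor `T_q` is pulled out; being an `L¹` contraction, it disappears from the bound.
  rw [← ccTranslate_sub]
  exact (norm_integral_cc_smul_le _ φ).trans (mul_le_mul_of_nonneg_left
    (hm.integral_abs_ccTranslate_le q _) (norm_nonneg _))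

end Smoothing

/-! ### Characters of the product -/

section ProductDual

variable {K H : Type*} [TopologicalSpace K] [T2Space K] [LocallyCompactSpace K]
  [MeasurableSpace K] [BorelSpace K] [TopologicalSpace H] [T2Space H] [LocallyCompactSpace H]
  [MeasurableSpace H] [BorelSpace H] [MeasurableSpace (K × H)] [BorelSpace (K × H)]
  [Hypergroup K] [Hypergroup H]

/-- The real case is applied to real and imaginary parts, as real linear functionals commute with
the integrals. -/
theorem integral_conv_prod (x y : K) (x' y' : H) {f : K × H → ℂ} (hf : Continuous f) :
    ∫ p, f p ∂(conv (x, x') (y, y')) = ∫ s, ∫ t, f (s, t) ∂(conv x' y') ∂(conv x y) := by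
  have hin : Continuous fun s => ∫ t, f (s, t) ∂(conv x' y') :=
    continuous_integral_conv_complex continuous_const continuous_const
      (G := fun s t => f (s, t)) hf
  have hL : ∀ L : ℂ →L[ℝ] ℝ, L (∫ p, f p ∂(conv (x, x') (y, y'))) =
      L (∫ s, ∫ t, f (s, t) ∂(conv x' y') ∂(conv x y)) := by
    intro L
    rw [← L.integral_comp_comm (integrable_conv _ _ hf),
      ← L.integral_comp_comm (integrable_conv _ _ hin)]
    refine (integral_prodConv x y x' y' (L.continuous.comp hf)).trans ?_
    refine integral_congr_ae (.of_forall fun s => ?_)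
    exact L.integral_comp_comm (integrable_conv x' y' (hf.comp (Continuous.prodMk_right s)))
  exact Complex.ext (hL Complex.reCLM) (hL Complex.imCLM)

theorem conv_left_right (x : K) (y : H) :
    conv ((x, e) : K × H) (e, y) = Measure.dirac (x, y) :=
  prodConv_eq_dirac (conv_e x) (e_conv y)

/-- The restriction of a character of `K × H` to `K`. -/
def Dual.restrictLeft (γ : Dual (K × H)) : Dual K :=
  ⟨γ.1.comp ⟨fun x => (x, e), by fun_prop⟩,
    fun h => one_ne_zero (γ.apply_e.symm.trans (DFunLike.congr_fun h e)),
    γ.2.2.1.imp fun _ hC x => hC _, fun x y => by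
      have h := γ.2.2.2.1 (x, e) (y, e)
      rw [integral_conv_prod _ _ _ _ γ.1.continuous] at h
      refine Eq.trans (integral_congr_ae (.of_forall fun s => ?_)) h
      exact (integral_conv_e (e : H) (fun t => γ.1 (s, t))
        (γ.1.continuous.comp (Continuous.prodMk_right s)).stronglyMeasurable).symm, fun x => by
      have h := γ.2.2.2.2 (x, e)
      change γ.1 (inv x, inv e) = _ at h
      rwa [inv_e] at h⟩

/-- The restriction of a character of `K × H` to `H`. -/
def Dual.restrictRight (γ : Dual (K × H)) : Dual H :=
  ⟨γ.1.comp ⟨fun y => (e, y), by fun_prop⟩,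
    fun h => one_ne_zero (γ.apply_e.symm.trans (DFunLike.congr_fun h e)),
    γ.2.2.1.imp fun _ hC x => hC _, fun x y => by
      have h := γ.2.2.2.1 (e, x) (e, y)
      rw [integral_conv_prod _ _ _ _ γ.1.continuous, integral_conv_e] at h
      · exact h
      · exact (continuous_integral_conv_complex continuous_const continuous_const
          (G := fun s t => γ.1 (s, t)) γ.1.continuous).stronglyMeasurable, fun x => by
      have h := γ.2.2.2.2 (e, x)
      change γ.1 (inv e, inv x) = _ at h
      rwa [inv_e] at h⟩

/-- Multiplicativity is applied to `δ_(x,e) * δ_(e,y) = δ_(x,y)`. -/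
theorem Dual.apply_prod (γ : Dual (K × H)) (x : K) (y : H) :
    γ.1 (x, y) = γ.1 (x, e) * γ.1 (e, y) := by
  rw [← γ.2.2.2.1, conv_left_right, integral_dirac' _ _ γ.1.continuous.stronglyMeasurable]

variable (K H) in
/-- The dual of a product is the product of the duals. -/
def dualProdHomeomorph : Dual K × Dual H ≃ₜ Dual (K × H) where
  toFun p := tensor p.1 p.2
  invFun γ := (γ.restrictLeft, γ.restrictRight)
  left_inv p := by
    refine Prod.ext (Subtype.ext (ContinuousMap.ext fun x => ?_))
      (Subtype.ext (ContinuousMap.ext fun y => ?_))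
    · change p.1.1 x * p.2.1 e = p.1.1 x
      rw [p.2.apply_e, mul_one]
    · change p.1.1 e * p.2.1 y = p.2.1 y
      rw [p.1.apply_e, one_mul]
  right_inv γ := Subtype.ext (ContinuousMap.ext fun p => (γ.apply_prod p.1 p.2).symm)
  continuous_toFun := by
    refine Continuous.subtype_mk ?_ _
    have h1 : Continuous fun p : Dual K × Dual H =>
        p.1.1.comp (⟨Prod.fst, continuous_fst⟩ : C(K × H, K)) :=
      (ContinuousMap.continuous_precomp _).comp (continuous_subtype_val.comp continuous_fst)
    have h2 : Continuous fun p : Dual K × Dual H =>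
        p.2.1.comp (⟨Prod.snd, continuous_snd⟩ : C(K × H, H)) :=
      (ContinuousMap.continuous_precomp _).comp (continuous_subtype_val.comp continuous_snd)
    exact h1.mul h2
  continuous_invFun :=
    (((ContinuousMap.continuous_precomp _).comp continuous_subtype_val).subtype_mk _).prodMk
      (((ContinuousMap.continuous_precomp _).comp continuous_subtype_val).subtype_mk _)

end ProductDual

/-! ### Amenability of the product -/

section ProductAmenable

variable {K H : Type*} [TopologicalSpace K] [T2Space K] [LocallyCompactSpace K]
  [MeasurableSpace K] [BorelSpace K] [TopologicalSpace H] [T2Space H] [LocallyCompactSpace H]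
  [MeasurableSpace H] [BorelSpace H] [MeasurableSpace (K × H)] [BorelSpace (K × H)]
  [CommHypergroup K] [CommHypergroup H]

/-- The map `f ↦ f ⊗ g` on bounded continuous functions. -/
def bcfTensorLeft (g : H →ᵇ ℂ) : (K →ᵇ ℂ) →L[ℂ] (K × H →ᵇ ℂ) :=
  LinearMap.mkContinuous
    { toFun := fun f => f.compContinuous ⟨Prod.fst, continuous_fst⟩ *
        g.compContinuous ⟨Prod.snd, continuous_snd⟩
      map_add' := fun f f' => by ext p; exact add_mul _ _ _
      map_smul' := fun c f => by ext p; exact mul_assoc _ _ _ } ‖g‖ fun f => by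
    refine (BoundedContinuousFunction.norm_le (by positivity)).mpr fun p => ?_
    change ‖f p.1 * g p.2‖ ≤ _
    rw [norm_mul, mul_comm]
    exact mul_le_mul (g.norm_coe_le_norm _) (f.norm_coe_le_norm _) (norm_nonneg _) (norm_nonneg _)

/-- The map `g ↦ f ⊗ g` on bounded continuous functions. -/
def bcfTensorRight (f : K →ᵇ ℂ) : (H →ᵇ ℂ) →L[ℂ] (K × H →ᵇ ℂ) :=
  LinearMap.mkContinuous
    { toFun := fun g => f.compContinuous ⟨Prod.fst, continuous_fst⟩ *
        g.compContinuous ⟨Prod.snd, continuous_snd⟩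
      map_add' := fun g g' => by ext p; exact mul_add _ _ _
      map_smul' := fun c g => by ext p; exact mul_left_comm _ _ _ } ‖f‖ fun g => by
    refine (BoundedContinuousFunction.norm_le (by positivity)).mpr fun p => ?_
    change ‖f p.1 * g p.2‖ ≤ _
    rw [norm_mul]
    exact mul_le_mul (f.norm_coe_le_norm _) (g.norm_coe_le_norm _) (norm_nonneg _) (norm_nonneg _)

theorem translate_e (f : K → ℂ) (hf : Continuous f) (y : K) : translate e f y = f y := by
  rw [translate, e_conv, integral_dirac' _ _ hf.stronglyMeasurable]

/-- The functional is `f ↦ N(f ⊗ β)`: `T_(x,e)(f ⊗ β) = T_x f ⊗ β` and `(α ⊗ β)(x, e) = α(x)`. -/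
theorem IsAmenableAt.left {mK : Measure K} (hK : IsHaarMeasure mK) {mKH : Measure (K × H)}
    {α : Dual K} {β : Dual H} (h : IsAmenableAt mKH (tensor α β)) : IsAmenableAt mK α := by
  obtain ⟨N, h1, h2⟩ := h.exists_functional
  refine hK.isAmenableAt_of_functional_bcf α (N.comp (bcfTensorLeft β.toBCF)) h1 fun x f => ?_
  have h3 := h2 (x, e) (bcfTensorLeft β.toBCF f)
  have h4 : translateBCF ((x, e) : K × H) (bcfTensorLeft β.toBCF f) =
      bcfTensorLeft β.toBCF (translateBCF x f) := by
    ext ⟨s, t⟩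
    refine (integral_tensor x s e t f.continuous β.1.continuous).trans ?_
    exact congrArg (translate x f s * ·) (translate_e β.1 β.1.continuous t)
  rw [h4] at h3
  refine h3.trans ?_
  change α.1 x * β.1 e * _ = _
  rw [β.apply_e, mul_one]; rfl

theorem IsAmenableAt.right {mH : Measure H} (hH : IsHaarMeasure mH) {mKH : Measure (K × H)}
    {α : Dual K} {β : Dual H} (h : IsAmenableAt mKH (tensor α β)) : IsAmenableAt mH β := by
  obtain ⟨N, h1, h2⟩ := h.exists_functional
  refine hH.isAmenableAt_of_functional_bcf β (N.comp (bcfTensorRight α.toBCF)) h1 fun y g => ?_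
  have h3 := h2 (e, y) (bcfTensorRight α.toBCF g)
  have h4 : translateBCF ((e, y) : K × H) (bcfTensorRight α.toBCF g) =
      bcfTensorRight α.toBCF (translateBCF y g) := by
    ext ⟨s, t⟩
    refine (integral_tensor e s y t α.1.continuous g.continuous).trans ?_
    exact congrArg (· * translate y g t) (translate_e α.1 α.1.continuous s)
  rw [h4] at h3
  refine h3.trans ?_
  change α.1 e * β.1 y * _ = _
  rw [α.apply_e, one_mul]; rfl

/-- The slice `f(x, ·)`. -/
def slice (f : K × H →ᵇ ℂ) (x : K) : H →ᵇ ℂ := f.compContinuous ⟨fun y => (x, y), by fun_prop⟩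

theorem norm_slice_le (f : K × H →ᵇ ℂ) (x : K) : ‖slice f x‖ ≤ ‖f‖ :=
  (BoundedContinuousFunction.norm_le (norm_nonneg f)).mpr fun y => f.norm_coe_le_norm (x, y)

variable (K H) in
/-- The bounded continuous functions on `K × H` whose slices depend norm continuously on the first
coordinate. -/
def sliceContinuous : Submodule ℂ (K × H →ᵇ ℂ) where
  carrier := {f | Continuous (slice f)}
  add_mem' hf hg := hf.add hg
  zero_mem' := (continuous_const : Continuous fun _ : K => (0 : H →ᵇ ℂ))
  smul_mem' c _ hf := hf.const_smul c

/-- Since `δ_(x̃,e) * δ_(e,ỹ)` is the point mass at `(x,y)~`, the difference of the slices at `x`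
and `x₀` is bounded, uniformly in `y`, by `‖φ‖` times the `L¹` distance of `T_(x̃,e) F` and
`T_(x̃₀,e) F`. -/
theorem smoothCLM_mem_sliceContinuous {m : Measure (K × H)} (hm : IsHaarMeasure m)
    (F : C_c(K × H, ℝ)) (φ : Lp ℂ ∞ m) : smoothCLM hm F φ ∈ sliceContinuous K H := by
  have := hm.isFiniteMeasureOnCompacts
  change Continuous fun x => slice (smoothCLM hm F φ) x
  rw [continuous_iff_continuousAt]
  intro x₀
  have hc : Continuous fun x : K => ‖φ‖ * ∫ y, |(ccTranslate ((inv x, e) : K × H) F -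
      ccTranslate (inv x₀, e) F) y| ∂m :=
    continuous_const.mul ((continuous_integral_abs_ccTranslate_sub F _).comp
      (continuous_inv.prodMk continuous_const))
  have h0 := hc.tendsto x₀
  simp only [sub_self, CompactlySupportedContinuousMap.zero_apply, abs_zero, integral_zero,
    mul_zero] at h0
  refine tendsto_iff_norm_sub_tendsto_zero.mpr (squeeze_zero (fun _ => norm_nonneg _)
    (fun x => ?_) h0)
  refine (BoundedContinuousFunction.norm_le (mul_nonneg (norm_nonneg _)
    (integral_nonneg fun _ => abs_nonneg _))).mpr fun y => ?_
  exact hm.norm_smooth_sub_le F φ (r := (x, y)) (r₀ := (x₀, y)) (q := (e, inv y))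
    (conv_left_right _ _) (conv_left_right _ _)

/-- The map `f ↦ (x ↦ N(f(x, ·)))`. -/
def sliceFunctional (N : StrongDual ℂ (H →ᵇ ℂ)) : sliceContinuous K H →L[ℂ] (K →ᵇ ℂ) :=
  have hb : ∀ (f : sliceContinuous K H) (x : K), ‖N (slice f.1 x)‖ ≤ ‖N‖ * ‖f‖ := fun f x =>
    (N.le_opNorm _).trans (mul_le_mul_of_nonneg_left (norm_slice_le f.1 x) (norm_nonneg N))
  LinearMap.mkContinuous
    { toFun := fun f => BoundedContinuousFunction.ofNormedAddCommGroup
        (fun x => N (slice f.1 x)) (N.continuous.comp f.2) _ (hb f)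
      map_add' := fun f g => by ext x; exact map_add N (slice f.1 x) (slice g.1 x)
      map_smul' := fun c f => by ext x; exact map_smul N c (slice f.1 x) } ‖N‖ fun f =>
    BoundedContinuousFunction.norm_ofNormedAddCommGroup_le _
      (mul_nonneg (norm_nonneg _) (norm_nonneg _)) (hb f)

theorem sliceFunctional_apply (N : StrongDual ℂ (H →ᵇ ℂ)) (f : sliceContinuous K H) (x : K) :
    sliceFunctional N f x = N (slice f.1 x) := rfl

/-- Norm continuity and compactness of `supp ω(x, s)` make the slices Bochner integrable, so a
bounded functional on the slices may later be moved under the integral. -/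
theorem slice_translateBCF {f : K × H →ᵇ ℂ} (hf : f ∈ sliceContinuous K H) (x s : K) (x' : H) :
    Integrable (slice f) (conv x s) ∧
    slice (translateBCF (x, x') f) s = translateBCF x' (∫ u, slice f u ∂(conv x s)) := by
  have hf : Continuous (slice f) := hf
  have hint : Integrable (slice f) (conv x s) := by
    have h := hf.continuousOn.integrableOn_compact (μ := conv x s) (isCompact_support_conv x s)
    rwa [IntegrableOn, Measure.restrict_eq_self_of_ae_mem (ae_mem_support (conv x s))] at h
  refine ⟨hint, ?_⟩
  ext t
  rw [← (translateBCF x').integral_comp_comm hint]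
  refine Eq.trans ?_ ((BoundedContinuousFunction.evalCLM ℂ t).integral_comp_comm
    ((translateBCF x').integrable_comp hint))
  exact integral_conv_prod x s x' t f.continuous

/-- The functional `f ↦ N(x ↦ N'(f(x,·)))` works on functions with norm continuous slices: applying
`N'` turns `T_(x,x')` into `β(x') T_x`, and `N` then contributes `α(x)`. -/
theorem IsAmenableAt.tensor {mK : Measure K} {mH : Measure H} {mKH : Measure (K × H)}
    (hm : IsHaarMeasure mKH) {α : Dual K} {β : Dual H} (hα : IsAmenableAt mK α)
    (hβ : IsAmenableAt mH β) : IsAmenableAt mKH (Hypergroup.tensor α β) := by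
  obtain ⟨N, h1, h2⟩ := hα.exists_functional
  obtain ⟨N', h1', h2'⟩ := hβ.exists_functional
  have hslice : ∀ x, slice (Hypergroup.tensor α β).toBCF x = α.1 x • β.toBCF := fun x => rfl
  have hmem : (Hypergroup.tensor α β).toBCF ∈ sliceContinuous K H := by
    change Continuous fun x => slice (Hypergroup.tensor α β).toBCF x
    simp_rw [hslice]
    exact α.1.continuous.smul continuous_const
  refine hm.isAmenableAt_of_functional _ (sliceContinuous K H)
    (smoothCLM_mem_sliceContinuous hm) hmem (N.comp (sliceFunctional N')) ?_ ?_
  · have h : sliceFunctional N' ⟨_, hmem⟩ = α.toBCF := by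
      ext x
      rw [sliceFunctional_apply, hslice, map_smul, h1', smul_eq_mul, mul_one]; rfl
    rw [ContinuousLinearMap.comp_apply, h, h1]
  · rintro ⟨x, x'⟩ f g hfg
    have h : sliceFunctional N' g = β.1 x' • translateBCF x (sliceFunctional N' f) := by
      ext s
      obtain ⟨hint, hs⟩ := slice_translateBCF f.2 x s x'
      rw [sliceFunctional_apply, hfg, hs, h2', ← N'.integral_comp_comm hint]
      rfl
    change N (sliceFunctional N' g) = α.1 x * β.1 x' * N (sliceFunctional N' f)
    rw [h, map_smul, h2, smul_eq_mul]
    ring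

end ProductAmenable

end Hypergroup

end

theorem mainTheorem5 {K H : Type*}
    [TopologicalSpace K] [T2Space K] [LocallyCompactSpace K] [MeasurableSpace K] [BorelSpace K]
    [TopologicalSpace H] [T2Space H] [LocallyCompactSpace H] [MeasurableSpace H] [BorelSpace H]
    [MeasurableSpace (K × H)] [BorelSpace (K × H)]
    [CommHypergroup K] [CommHypergroup H] :
    IsHomeomorph (fun p : Hypergroup.Dual K × Hypergroup.Dual H => Hypergroup.tensor p.1 p.2) ∧
    ∀ (mK : Measure K) (mH : Measure H) (mKH : Measure (K × H)),
      Hypergroup.IsHaarMeasure mK → Hypergroup.IsHaarMeasure mH → Hypergroup.IsHaarMeasure mKH →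
      ∀ (α : Hypergroup.Dual K) (β : Hypergroup.Dual H),
        Hypergroup.IsAmenableAt mKH (Hypergroup.tensor α β) ↔
          Hypergroup.IsAmenableAt mK α ∧ Hypergroup.IsAmenableAt mH β := by
  refine ⟨(Hypergroup.dualProdHomeomorph K H).isHomeomorph, fun mK mH mKH hK hH hKH α β =>
    ⟨fun h => ⟨h.left hK, h.right hH⟩, fun h => h.1.tensor hKH h.2⟩⟩
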